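/- Let $\Omega=(0,1)^2$ and let $\omega$ be a connected open set with $\overline\omega\subset\Omega$ whose boundary $\gamma$ is smooth, i.e. $\gamma$ is a finite disjoint union of $C^\infty$ simple closed curves, with arc-length measure $d\ell$. For $0\le r<1/2$ let $H^r(\gamma)$ be the space of $w\in L^2(\gamma)$ with finite norm $$\|w\|_{r,\gamma}=\Big(\int_\gamma |w|^2\,d\ell\Big)^{1/2}+\Big(\int_\gamma\int_\gamma\frac{|w(x)-w(y)|^2}{|x-y|^{1+2r}}\,d\ell(x)\,d\ell(y)\Big)^{1/2},$$ where the second term is omitted for $r=0$. Let $H^{-r}(\gamma)$ be its dual, with the dual norm $\|\cdot\|_{-r,\gamma}$ and the duality pairing $\langle\cdot,\cdot\rangle$. Let $0<s\le 1/2$, $\sigma>0$ and $0<c<c'$. There is a constant $C>0$, depending only on $\gamma$ (with $\omega$), $s$, $\sigma$, $c$, $c'$, such that the following holds. Let $h>0$ and let $T_h$ be a (finite) conforming triangulation of $\overline\Omega$ such that every triangle $K\in T_h$ contains a disc of radius $\operatorname{diam}(K)/\sigma$ and satisfies $h\le\sigma\operatorname{diam}(K)$ (for instance a member of a shape-regular,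 quasi-uniform family of triangulations with mesh size $h$). Let $V_h$ be the space of functions that are continuous on $\overline\Omega$ and affine on every $K\in T_h$. Let $\tilde h>0$ and let $\gamma_1,\dots,\gamma_N$ be a subdivision of $\gamma$ into arcs with disjoint interiors and lengths $c\tilde h\le|\gamma_i|\le c'\tilde h$, and let $x_i\in\gamma_i$ for $i=1,\dots,N$. Then $\mathbf 1_{\gamma_i}\in H^{1/2-s}(\gamma)$ for every $i$, and $v_h|_\gamma\in H^{1/2-s}(\gamma)$ for every $v_h\in V_h$; and for every $\varphi\in H^{-1/2+s}(\gamma)$, with $$\varphi_{\tilde h}=\sum_{i=1}^N\lambda_i\delta_{x_i},\qquad \lambda_i=\langle\varphi,\mathbf 1_{\gamma_i}\rangle,\qquad \langle\varphi_{\tilde h},v_h\rangle=\sum_{i=1}^N\lambda_i v_h(x_i),$$ one has for all $v_h\in V_h$ $$|\langle\varphi,v_h\rangle-\langle\varphi_{\tilde h},v_h\rangle|\le C\Big(\frac{\tilde h}{h}\Big)^{1/2}\tilde h^{\,s}\,\|\varphi\|_{-1/2+s,\gamma}\,|v_h|_{1,\Omega},\qquad |v_h|_{1,\Omega}=\Big(\int_\Omega|\nabla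 v_h|^2\Big)^{1/2}.$$ -/

import Mathlib

open MeasureTheory Set
open scoped ENNReal

noncomputable section

namespace SingleLayer

/-- The Euclidean plane. -/
abbrev Plane : Type := EuclideanSpace ℝ (Fin 2)

/-- The open unit square `(0, 1) × (0, 1)`. -/
def unitSquare : Set Plane := {x | ∀ i, x i ∈ Ioo (0 : ℝ) 1}

/-! ### Smooth boundaries and arc length -/

/-- The boundary of the plane set `ω` is smooth: it is the union of finitely many pairwise disjoint
smooth simple closed curves. The `k`-th curve, of length `L k`, is given by an arc-length
parametrization `X k`, extended periodically to the real line. -/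
structure SmoothBoundary (ω : Set Plane) where
  /-- the number of connected components of the boundary -/
  m : ℕ
  /-- the lengths of the components -/
  L : Fin m → ℝ
  /-- the arc-length parametrizations of the components -/
  X : Fin m → ℝ → Plane
  L_pos : ∀ k, 0 < L k
  smooth : ∀ k, ContDiff ℝ (⊤ : ℕ∞) (X k)
  unit_speed : ∀ k t, ‖deriv (X k) t‖ = 1
  periodic : ∀ k, Function.Periodic (X k) (L k)
  simple : ∀ k, InjOn (X k) (Ico 0 (L k))
  disjoint : ∀ k l, k ≠ l → Disjoint (range (X k)) (range (X l))
  frontier_eq : frontier ω = ⋃ k, range (X k)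

/-- The arc-length measure of the boundary curve `γ`, as a measure on the plane:
`∫ f = ∑ₖ ∫₀^{L k} f (X k t) dt`. -/
def SmoothBoundary.arcLength {ω : Set Plane} (Γ : SmoothBoundary ω) : Measure Plane :=
  ∑ k, (volume.restrict (Ioc 0 (Γ.L k))).map (Γ.X k)

/-- A subdivision of the boundary curve `γ` into `N` closed arcs with pairwise disjoint interiors.
The `i`-th arc is the image of `[a i, b i]` under the parametrization of component `comp i`. -/
structure Subdivision {ω : Set Plane} (Γ : SmoothBoundary ω) where
  /-- the number of arcs -/
  N : ℕ
  /-- the component on which each arc lies -/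
  comp : Fin N → Fin Γ.m
  /-- the initial parameters -/
  a : Fin N → ℝ
  /-- the final parameters -/
  b : Fin N → ℝ
  lt : ∀ i, a i < b i
  le_period : ∀ i, b i ≤ a i + Γ.L (comp i)
  cover : ⋃ i, Γ.X (comp i) '' Icc (a i) (b i) = frontier ω
  nonoverlap : ∀ i j, i ≠ j →
    Disjoint (Γ.X (comp i) '' Ioo (a i) (b i)) (Γ.X (comp j) '' Ioo (a j) (b j))

namespace Subdivision

variable {ω : Set Plane} {Γ : SmoothBoundary ω}

/-- The `i`-th (closed) arc `γᵢ` of a subdivision. -/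
def arc (S : Subdivision Γ) (i : Fin S.N) : Set Plane :=
  Γ.X (S.comp i) '' Icc (S.a i) (S.b i)

/-- The length `|γᵢ|` of the `i`-th arc. -/
def length (S : Subdivision Γ) (i : Fin S.N) : ℝ := S.b i - S.a i

/-- Quasi-uniformity with mesh size `h`: `c h ≤ |γᵢ| ≤ C h` for all arcs. -/
def IsQuasiUniform (S : Subdivision Γ) (c C h : ℝ) : Prop :=
  ∀ i, c * h ≤ S.length i ∧ S.length i ≤ C * h

/-- The characteristic function of the `i`-th arc. -/
def arcIndicator (S : Subdivision Γ) (i : Fin S.N) : Plane → ℝ :=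
  (S.arc i).indicator fun _ => 1

end Subdivision

/-! ### Fractional Sobolev spaces and their duals -/

/-- The integrand of the Gagliardo seminorm of order `r`: for `r ≠ 0` it is
`(w x - w y) / |x - y| ^ (1 / 2 + r)`, so that its square is `|w x - w y|² / |x - y| ^ (1 + 2 r)`.
For `r = 0` it is zero, so that the space of order `0` is `L²`. -/
def gagliardo (r : ℝ) (w : Plane → ℝ) (p : Plane × Plane) : ℝ :=
  if r = 0 then 0 else (w p.1 - w p.2) / ‖p.1 - p.2‖ ^ (1 / 2 + r)

theorem gagliardo_zero (r : ℝ) : gagliardo r 0 = 0 := by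
  ext p; simp [gagliardo]

theorem gagliardo_add (r : ℝ) (v w : Plane → ℝ) :
    gagliardo r (v + w) = gagliardo r v + gagliardo r w := by
  ext p
  by_cases hr : r = 0
  · simp [gagliardo, hr]
  · simp only [gagliardo, hr, if_false, Pi.add_apply]
    ring

theorem gagliardo_smul (r a : ℝ) (w : Plane → ℝ) :
    gagliardo r (a • w) = a • gagliardo r w := by
  ext p
  by_cases hr : r = 0
  · simp [gagliardo, hr]
  · simp only [gagliardo, hr, if_false, Pi.smul_apply, smul_eq_mul]
    ring

/-- The space `H^r(γ)` for `0 ≤ r < 1`, where `μ` is the arc-length measure of `γ`: square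
integrable functions for which the double integral over `γ × γ` of
`|w x - w y|² / |x - y| ^ (1 + 2 r)` is finite (no second condition for `r = 0`).
Only the values on `γ` matter, and functions equal almost everywhere on `γ` are at distance `0`. -/
def fracSobolev (μ : Measure Plane) (r : ℝ) : Submodule ℝ (Plane → ℝ) where
  carrier := {w | MemLp w 2 μ ∧ MemLp (gagliardo r w) 2 (μ.prod μ)}
  zero_mem' := by
    refine ⟨MemLp.zero, ?_⟩
    rw [gagliardo_zero]
    exact MemLp.zero
  add_mem' := by
    rintro v w ⟨hv, hv'⟩ ⟨hw, hw'⟩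
    refine ⟨hv.add hw, ?_⟩
    rw [gagliardo_add]
    exact hv'.add hw'
  smul_mem' := by
    rintro a w ⟨hw, hw'⟩
    refine ⟨hw.const_smul a, ?_⟩
    rw [gagliardo_smul]
    exact hw'.const_smul a

/-- The space `H^r(γ)` as a type of its own, so that it does not inherit the topology of pointwise
convergence from the space of all functions. -/
def FracSobolev (μ : Measure Plane) (r : ℝ) : Type := fracSobolev μ r

namespace FracSobolev

variable {μ : Measure Plane} {r : ℝ}

instance : AddCommGroup (FracSobolev μ r) := inferInstanceAs (AddCommGroup (fracSobolev μ r))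

instance : Module ℝ (FracSobolev μ r) := inferInstanceAs (Module ℝ (fracSobolev μ r))

/-- A function that satisfies the conditions, as an element of `H^r(γ)`. -/
def mk (w : Plane → ℝ) (hw : w ∈ fracSobolev μ r) : FracSobolev μ r := ⟨w, hw⟩

/-- The function underlying an element of `H^r(γ)`. -/
def toFun (w : FracSobolev μ r) : Plane → ℝ := Subtype.val w

theorem toFun_mem (w : FracSobolev μ r) : w.toFun ∈ fracSobolev μ r := Subtype.property w

theorem toFun_mk (w : Plane → ℝ) (hw : w ∈ fracSobolev μ r) : (mk w hw).toFun = w := rfl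

theorem toFun_add (v w : FracSobolev μ r) : (v + w).toFun = v.toFun + w.toFun := rfl

theorem toFun_smul (a : ℝ) (w : FracSobolev μ r) : (a • w).toFun = a • w.toFun := rfl

/-- The norm of `H^r(γ)`: the sum of the `L²` norm and of the Gagliardo seminorm
`(∫∫ |w x - w y|² / |x - y| ^ (1 + 2 r)) ^ (1 / 2)` (absent for `r = 0`). -/
instance : Norm (FracSobolev μ r) where
  norm w := (eLpNorm w.toFun 2 μ).toReal + (eLpNorm (gagliardo r w.toFun) 2 (μ.prod μ)).toReal

theorem norm_def (w : FracSobolev μ r) :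
    ‖w‖ = (eLpNorm w.toFun 2 μ).toReal + (eLpNorm (gagliardo r w.toFun) 2 (μ.prod μ)).toReal := rfl

theorem core (μ : Measure Plane) (r : ℝ) : SeminormedSpace.Core ℝ (FracSobolev μ r) where
  norm_nonneg w := by rw [norm_def]; positivity
  norm_smul a w := by
    simp only [norm_def, toFun_smul, gagliardo_smul, eLpNorm_const_smul,
      ENNReal.toReal_mul, toReal_enorm]
    ring
  norm_triangle v w := by
    simp only [norm_def, toFun_add, gagliardo_add]
    obtain ⟨hv, hv'⟩ := v.toFun_mem
    obtain ⟨hw, hw'⟩ := w.toFun_mem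
    have h1 : (eLpNorm (v.toFun + w.toFun) 2 μ).toReal ≤
        (eLpNorm v.toFun 2 μ).toReal + (eLpNorm w.toFun 2 μ).toReal := by
      rw [← ENNReal.toReal_add hv.2.ne hw.2.ne]
      exact ENNReal.toReal_mono (ENNReal.add_ne_top.2 ⟨hv.2.ne, hw.2.ne⟩)
        (eLpNorm_add_le hv.1 hw.1 one_le_two)
    have h2 : (eLpNorm (gagliardo r v.toFun + gagliardo r w.toFun) 2 (μ.prod μ)).toReal ≤
        (eLpNorm (gagliardo r v.toFun) 2 (μ.prod μ)).toReal +
          (eLpNorm (gagliardo r w.toFun) 2 (μ.prod μ)).toReal := by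
      rw [← ENNReal.toReal_add hv'.2.ne hw'.2.ne]
      exact ENNReal.toReal_mono (ENNReal.add_ne_top.2 ⟨hv'.2.ne, hw'.2.ne⟩)
        (eLpNorm_add_le hv'.1 hw'.1 one_le_two)
    linarith

instance : SeminormedAddCommGroup (FracSobolev μ r) :=
  SeminormedAddCommGroup.ofCore (core μ r)

instance : NormedSpace ℝ (FracSobolev μ r) where
  norm_smul_le a w := ((core μ r).norm_smul a w).le

end FracSobolev

/-- The space `H^{-r}(γ)`, the dual of `H^r(γ)`, with its dual norm. -/
abbrev DualSobolev (μ : Measure Plane) (r : ℝ) : Type := StrongDual ℝ (FracSobolev μ r)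

/-! ### Triangulations and `P¹` finite elements -/

/-- A conforming triangulation of `Ω`: a finite simplicial complex that fills the closure of
`Ω`. -/
structure Triangulation (Ω : Set Plane) where
  /-- the underlying simplicial complex -/
  complex : Geometry.SimplicialComplex ℝ Plane
  finite : complex.faces.Finite
  space_eq : complex.space = closure Ω

namespace Triangulation

variable {Ω : Set Plane}

/-- The (closed) triangles of a triangulation. -/
def cells (T : Triangulation Ω) : Set (Set Plane) :=
  {K | ∃ f ∈ T.complex.faces, f.card = 3 ∧ K = convexHull ℝ (f : Set Plane)}

/-- Regularity with constant `σ` and mesh size `h`: every triangle `K` contains a disc of radius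
`diam K / σ` (shape regularity) and has diameter at least `h / σ`. -/
def IsRegular (T : Triangulation Ω) (σ h : ℝ) : Prop :=
  ∀ K ∈ T.cells,
    (∃ z, Metric.closedBall z (Metric.diam K / σ) ⊆ K) ∧ h ≤ σ * Metric.diam K

/-- The `P¹` finite element space: functions that are continuous on the closure of `Ω` and affine
on each triangle. -/
def IsP1 (T : Triangulation Ω) (v : Plane → ℝ) : Prop :=
  ContinuousOn v (closure Ω) ∧ ∀ K ∈ T.cells, ∃ g : Plane →ᵃ[ℝ] ℝ, EqOn v g K

end Triangulation

/-- The `H¹` seminorm `(∫_Ω |∇ v|²) ^ (1 / 2)` of a function that is differentiable almost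
everywhere, such as a `P¹` finite element function. -/
def h1Seminorm (Ω : Set Plane) (v : Plane → ℝ) : ℝ :=
  √(∫ x in Ω, ‖fderiv ℝ v x‖ ^ 2)

/-! ### Combinations of Dirac masses -/

/-- The combination of Dirac masses `∑ᵢ lam i δ_{x i}`, acting on functions. -/
def diracSum {N : ℕ} (lam : Fin N → ℝ) (x : Fin N → Plane) : (Plane → ℝ) →ₗ[ℝ] ℝ :=
  ∑ i, lam i • LinearMap.proj (x i)

end SingleLayer

end

open SingleLayer

/-! Lumping the functional `φ` at the points `x i` means applying `φ` to the piecewise constant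
function on the arcs that interpolates `v` there (`dual_sub_diracSum_eq`). So the error of the lumped
functional is `φ` applied to the interpolation error `e`, and the claim is a bound for the norm of
`e` in `H^r(γ)` with `r = 1 / 2 - s`, which lies in `[0, 1 / 2)`.

Let `D i` be the integral over the `i`-th arc, of length `l i`, of the squared gradient of `v`. By
Cauchy-Schwarz along the curve, `|v x - v y|² ≤ d(x, y) * D i` for points of this arc at distance
`d(x, y)` along it; in particular `e² ≤ l i * D i` there.

* For the `L²` norm, integrate this over the arc and sum over `i`
  (`lintegral_interpolation_error_sq_le`).
* For the Gagliardo seminorm, with kernel `|x - y| ^ (-p)` and `p = 1 + 2 r`, pairs on the same arc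
  contribute at most `D i` times the integral of `d(x, y) |x - y| ^ (-p)`
  (`exists_lintegral_abs_mul_kernel_le`), and pairs on different arcs at most `4 * l i * D i` times
  the integral of the kernel over the arc and its complement
  (`exists_lintegral_kernel_arc_compl_le`). The latter is of the order `l i ^ (1 - 2 r)`, which is
  where `r < 1 / 2` enters. Both rest on the chord-arc inequality `exists_chord_arc` and on the
  positive distance of different boundary components. The sum of the contributions is at most a
  constant times the sum of the `l i ^ (2 - 2 r) * D i`.

It remains to compare the sum of the `D i` with the squared `H¹` seminorm of `v`. On a triangle `K`
the gradient is constant, and the curve meets `K` in a length of at most the order of `diam K`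
(`exists_arcLength_le_diam`), while the area of `K` is at least of the order of `diam K ^ 2` and
`diam K` at least of the order of `h`. Hence the sum of the `D i` is at most `C / h * |v|₁²`
(`exists_lintegral_gradientSq_le`), and with `2 - 2 r = 1 + 2 s` the bound follows. The curve may run
along edges, where the gradient of `v` is not defined, so the gradient is replaced there by those
of all adjacent triangles; `v` along the curve is Lipschitz, and its derivative is bounded by one of
them wherever it exists (`exists_cell_abs_deriv_le`). -/

namespace SingleLayer

/-! ### Geometry of the boundary curve -/

namespace SmoothBoundary

variable {ω : Set Plane} (Γ : SmoothBoundary ω)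

theorem continuous_X (k : Fin Γ.m) : Continuous (Γ.X k) := (Γ.smooth k).continuous

theorem lipschitzWith_X (k : Fin Γ.m) : LipschitzWith 1 (Γ.X k) :=
  lipschitzWith_of_nnnorm_deriv_le ((Γ.smooth k).differentiable (by simp)) fun t => by
    rw [← NNReal.coe_le_coe, coe_nnnorm, Γ.unit_speed k t, NNReal.coe_one]

/-- On one period, the parametrization only takes a value twice at the two endpoints. -/
theorem X_add_ne (k : Fin Γ.m) (t : ℝ) {u : ℝ} (hu : u ∈ Ioo 0 (Γ.L k)) :
    Γ.X k (t + u) ≠ Γ.X k t := by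
  intro h
  have hL := Γ.L_pos k
  have hp := Γ.periodic k
  have e1 : Γ.X k (toIcoMod hL 0 (t + u)) = Γ.X k (toIcoMod hL 0 t) := by
    rw [toIcoMod, toIcoMod, hp.sub_zsmul_eq, hp.sub_zsmul_eq, h]
  have e2 := Γ.simple k (by simpa using toIcoMod_mem_Ico hL 0 (t + u))
    (by simpa using toIcoMod_mem_Ico hL 0 t) e1
  rw [toIcoMod, toIcoMod] at e2
  simp only [zsmul_eq_mul] at e2
  set n := toIcoDiv hL 0 (t + u)
  set m := toIcoDiv hL 0 t
  have e3 : u = ((n - m : ℤ) : ℝ) * Γ.L k := by push_cast; linarith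
  have h1 : (0 : ℝ) < ((n - m : ℤ) : ℝ) := by
    by_contra! h0
    nlinarith [hu.1]
  have h2 : ((n - m : ℤ) : ℝ) < 1 := by
    by_contra! h0
    nlinarith [hu.2]
  have h1' : 0 < n - m := by exact_mod_cast h1
  have h2' : n - m < 1 := by exact_mod_cast h2
  omega

/-- For a curve of unit speed, short chords are at least half as long as the arcs. -/
theorem exists_local_chord_arc (k : Fin Γ.m) :
    ∃ δ > 0, ∀ t u : ℝ, |u| ≤ δ → |u| / 2 ≤ ‖Γ.X k (t + u) - Γ.X k t‖ := by
  have hL := Γ.L_pos k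
  have hd : Differentiable ℝ (Γ.X k) := (Γ.smooth k).differentiable (by simp)
  have hc : Continuous (deriv (Γ.X k)) := (Γ.smooth k).continuous_deriv (by simp)
  have huc : UniformContinuousOn (deriv (Γ.X k)) (Icc (-1) (Γ.L k + 1)) :=
    isCompact_Icc.uniformContinuousOn_of_continuous hc.continuousOn
  obtain ⟨δ, hδ, H⟩ := Metric.uniformContinuousOn_iff.1 huc (1 / 2) (by norm_num)
  -- the estimate for base points in one period
  have key : ∀ t ∈ Icc 0 (Γ.L k), ∀ u : ℝ, |u| ≤ min (δ / 2) 1 →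
      |u| / 2 ≤ ‖Γ.X k (t + u) - Γ.X k t‖ := by
    intro t ht u hu
    have hu1 : |u| ≤ δ / 2 := hu.trans (min_le_left _ _)
    have hu2 : |u| ≤ 1 := hu.trans (min_le_right _ _)
    have htm : t ∈ Icc (-1) (Γ.L k + 1) := ⟨by linarith [ht.1], by linarith [ht.2]⟩
    have hsub : uIcc t (t + u) ⊆ Icc (-1) (Γ.L k + 1) := by
      refine (convex_Icc _ _).ordConnected.uIcc_subset htm ?_
      rw [abs_le] at hu2
      exact ⟨by linarith [ht.1], by linarith [ht.2]⟩
    have hbound : ∀ x ∈ uIcc t (t + u),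
        ‖deriv (Γ.X k) x - deriv (Γ.X k) t‖ ≤ 1 / 2 := by
      intro x hx
      rw [← dist_eq_norm]
      refine (H x (hsub hx) t htm ?_).le
      rw [dist_comm, Real.dist_eq]
      have := abs_sub_left_of_mem_uIcc hx
      rw [abs_sub_comm]
      calc |x - t| ≤ |t + u - t| := this
        _ = |u| := by congr 1; ring
        _ < δ := by linarith
    have hmv := (convex_uIcc t (t + u)).norm_image_sub_le_of_norm_hasDerivWithin_le
      (f := fun x => Γ.X k x - x • deriv (Γ.X k) t)
      (f' := fun x => deriv (Γ.X k) x - deriv (Γ.X k) t) (C := 1 / 2)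
      (fun x _ => by
        have h2 := (hasDerivAt_id x).smul_const (deriv (Γ.X k) t)
        simp only [one_smul] at h2
        exact ((hd x).hasDerivAt.sub h2).hasDerivWithinAt)
      hbound left_mem_uIcc right_mem_uIcc
    have e1 : Γ.X k (t + u) - (t + u) • deriv (Γ.X k) t - (Γ.X k t - t • deriv (Γ.X k) t)
        = (Γ.X k (t + u) - Γ.X k t) - u • deriv (Γ.X k) t := by
      rw [add_smul]; abel
    rw [e1, add_sub_cancel_left, Real.norm_eq_abs] at hmv
    have e2 : ‖u • deriv (Γ.X k) t‖ = |u| := by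
      rw [norm_smul, Γ.unit_speed, mul_one, Real.norm_eq_abs]
    have := norm_sub_norm_le (u • deriv (Γ.X k) t) (Γ.X k (t + u) - Γ.X k t)
    rw [norm_sub_rev (u • deriv (Γ.X k) t) (Γ.X k (t + u) - Γ.X k t)] at this
    linarith
  refine ⟨min (δ / 2) 1, by positivity, fun t u hu => ?_⟩
  have hp := Γ.periodic k
  have h0 := key (toIcoMod hL 0 t)
    (by have := toIcoMod_mem_Ico hL 0 t; exact ⟨this.1, by simpa using this.2.le⟩) u hu
  have e1 : Γ.X k (toIcoMod hL 0 t + u) = Γ.X k (t + u) := by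
    rw [toIcoMod, sub_add_eq_add_sub, hp.sub_zsmul_eq]
  rwa [e1, toIcoMod, hp.sub_zsmul_eq] at h0

/-- Chord-arc inequality: on a simple closed curve, the distance of two points in the plane
dominates their distance along the curve. -/
theorem exists_chord_arc_single (k : Fin Γ.m) :
    ∃ κ > 0, ∀ t u : ℝ, u ∈ Icc 0 (Γ.L k) →
      κ * min u (Γ.L k - u) ≤ ‖Γ.X k (t + u) - Γ.X k t‖ := by
  have hL := Γ.L_pos k
  have hp := Γ.periodic k
  obtain ⟨δ, hδ, hloc⟩ := Γ.exists_local_chord_arc k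
  obtain ⟨η, hη, hfar⟩ : ∃ η > 0, ∀ t ∈ Icc 0 (Γ.L k), ∀ u ∈ Icc δ (Γ.L k - δ),
      η ≤ ‖Γ.X k (t + u) - Γ.X k t‖ := by
    have hcomp : IsCompact (Icc 0 (Γ.L k) ×ˢ Icc δ (Γ.L k - δ)) := isCompact_Icc.prod isCompact_Icc
    rcases (Icc 0 (Γ.L k) ×ˢ Icc δ (Γ.L k - δ)).eq_empty_or_nonempty with he | hne
    · refine ⟨1, one_pos, fun t ht u hu => ?_⟩
      have : (t, u) ∈ Icc 0 (Γ.L k) ×ˢ Icc δ (Γ.L k - δ) := ⟨ht, hu⟩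
      simp [he] at this
    · have hX := Γ.continuous_X k
      have hf : Continuous fun q : ℝ × ℝ => ‖Γ.X k (q.1 + q.2) - Γ.X k q.1‖ := by fun_prop
      obtain ⟨q, hq, hmin⟩ := hcomp.exists_isMinOn hne hf.continuousOn
      refine ⟨‖Γ.X k (q.1 + q.2) - Γ.X k q.1‖,
        norm_pos_iff.2 (sub_ne_zero.2 (Γ.X_add_ne k q.1 (u := q.2) ?_)),
        fun t ht u hu => isMinOn_iff.1 hmin (t, u) ⟨ht, hu⟩⟩
      exact ⟨hδ.trans_le hq.2.1, hq.2.2.trans_lt (by linarith)⟩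
  refine ⟨min (1 / 2) (η / Γ.L k), by positivity, fun t u hu => ?_⟩
  have hm : 0 ≤ min u (Γ.L k - u) := le_min hu.1 (by linarith [hu.2])
  rcases le_total u δ with h1 | h1
  · have := hloc t u (by rwa [abs_of_nonneg hu.1])
    rw [abs_of_nonneg hu.1] at this
    calc _ ≤ 1 / 2 * u := mul_le_mul (min_le_left _ _) (min_le_left _ _) hm (by norm_num)
      _ ≤ _ := by linarith
  rcases le_total (Γ.L k - δ) u with h2 | h2
  · -- the chord is short because the parameters are close modulo the period
    have h3 : |u - Γ.L k| = Γ.L k - u := by rw [abs_sub_comm, abs_of_nonneg (by linarith [hu.2])]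
    have := hloc t (u - Γ.L k) (by rw [h3]; linarith)
    rw [h3, ← add_sub_assoc, hp.sub_eq] at this
    calc _ ≤ 1 / 2 * (Γ.L k - u) :=
          mul_le_mul (min_le_left _ _) (min_le_right _ _) hm (by norm_num)
      _ ≤ _ := by linarith
  · have h0 := hfar (toIcoMod hL 0 t)
      (by have := toIcoMod_mem_Ico hL 0 t; exact ⟨this.1, by simpa using this.2.le⟩) u ⟨h1, h2⟩
    have e1 : Γ.X k (toIcoMod hL 0 t + u) = Γ.X k (t + u) := by
      rw [toIcoMod, sub_add_eq_add_sub, hp.sub_zsmul_eq]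
    rw [e1, toIcoMod, hp.sub_zsmul_eq] at h0
    refine le_trans ?_ h0
    calc _ ≤ η / Γ.L k * Γ.L k :=
          mul_le_mul (min_le_right _ _) ((min_le_left _ _).trans hu.2) hm (by positivity)
      _ = η := by field_simp

theorem exists_chord_arc :
    ∃ κ > 0, ∀ k, ∀ t u : ℝ, u ∈ Icc 0 (Γ.L k) →
      κ * min u (Γ.L k - u) ≤ ‖Γ.X k (t + u) - Γ.X k t‖ := by
  choose κ hκ H using Γ.exists_chord_arc_single
  rcases isEmpty_or_nonempty (Fin Γ.m) with he | hne
  · exact ⟨1, one_pos, fun k => he.elim k⟩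
  obtain ⟨k₀, hk₀⟩ := Finite.exists_min κ
  refine ⟨κ k₀, hκ k₀, fun k t u hu => le_trans ?_ (H k t u hu)⟩
  exact mul_le_mul_of_nonneg_right (hk₀ k) (le_min hu.1 (by linarith [hu.2]))

theorem range_X_eq (k : Fin Γ.m) : range (Γ.X k) = Γ.X k '' Icc 0 (Γ.L k) := by
  simpa using ((Γ.periodic k).image_Icc (Γ.L_pos k) 0).symm

/-- Distinct boundary components are a positive distance apart. -/
theorem exists_dist_components :
    ∃ δ > 0, ∀ k l, k ≠ l → ∀ t u : ℝ, δ ≤ ‖Γ.X k t - Γ.X l u‖ := by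
  have key : ∀ q : Fin Γ.m × Fin Γ.m, ∃ δ > 0, q.1 ≠ q.2 →
      ∀ t u : ℝ, δ ≤ ‖Γ.X q.1 t - Γ.X q.2 u‖ := by
    rintro ⟨k, l⟩
    by_cases hkl : k = l
    · exact ⟨1, one_pos, fun h => absurd hkl h⟩
    have hc : ∀ j, IsCompact (range (Γ.X j)) := fun j => by
      rw [Γ.range_X_eq]; exact isCompact_Icc.image (Γ.continuous_X j)
    obtain ⟨δ, hδ, H⟩ := (Γ.disjoint k l hkl).exists_thickenings (hc k) (hc l).isClosed
    refine ⟨δ, hδ, fun _ t u => ?_⟩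
    by_contra! hlt
    have h1 : Γ.X l u ∈ Metric.thickening δ (range (Γ.X k)) :=
      Metric.mem_thickening_iff.2 ⟨_, mem_range_self t, by rwa [dist_comm, dist_eq_norm]⟩
    exact H.le_bot ⟨h1, Metric.self_subset_thickening hδ _ (mem_range_self u)⟩
  choose δ hδ H using key
  rcases isEmpty_or_nonempty (Fin Γ.m) with he | hne
  · exact ⟨1, one_pos, fun k => he.elim k⟩
  obtain ⟨q, hq⟩ := Finite.exists_min δ
  exact ⟨δ q, hδ q, fun k l hkl t u => (hq (k, l)).trans (H (k, l) hkl t u)⟩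

/-! ### Arc length -/

theorem measurable_X (k : Fin Γ.m) : Measurable (Γ.X k) := (Γ.continuous_X k).measurable

theorem lintegral_arcLength {f : Plane → ℝ≥0∞} (hf : Measurable f) :
    ∫⁻ x, f x ∂Γ.arcLength = ∑ k, ∫⁻ t in Ioc 0 (Γ.L k), f (Γ.X k t) := by
  rw [arcLength, lintegral_finsetSum_measure]
  exact Finset.sum_congr rfl fun k _ => lintegral_map hf (Γ.measurable_X k)

theorem arcLength_apply {A : Set Plane} (hA : MeasurableSet A) :
    Γ.arcLength A = ∑ k, volume {t ∈ Ioc 0 (Γ.L k) | Γ.X k t ∈ A} := by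
  rw [arcLength, Measure.finsetSum_apply]
  refine Finset.sum_congr rfl fun k _ => ?_
  rw [Measure.map_apply (Γ.measurable_X k) hA,
    Measure.restrict_apply (Γ.measurable_X k hA), inter_comm]
  rfl

/-- The total length of the boundary. -/
def totalLength : ℝ := ∑ k, Γ.L k

theorem L_le_totalLength (k : Fin Γ.m) : Γ.L k ≤ Γ.totalLength :=
  Finset.single_le_sum (f := Γ.L) (fun j _ => (Γ.L_pos j).le) (Finset.mem_univ k)

theorem totalLength_nonneg : 0 ≤ Γ.totalLength :=
  Finset.sum_nonneg fun j _ => (Γ.L_pos j).le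

theorem arcLength_univ : Γ.arcLength univ = ENNReal.ofReal Γ.totalLength := by
  rw [arcLength_apply Γ .univ, totalLength, ENNReal.ofReal_sum_of_nonneg fun j _ => (Γ.L_pos j).le]
  refine Finset.sum_congr rfl fun k _ => ?_
  have : {t | t ∈ Ioc 0 (Γ.L k) ∧ Γ.X k t ∈ univ} = Ioc 0 (Γ.L k) := by ext; simp
  rw [this, Real.volume_Ioc, sub_zero]

instance : IsFiniteMeasure Γ.arcLength := ⟨by rw [arcLength_univ]; exact ENNReal.ofReal_lt_top⟩

theorem setLIntegral_period (k : Fin Γ.m) (f : Plane → ℝ≥0∞) (a b : ℝ) :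
    ∫⁻ t in Ioc a (a + Γ.L k), f (Γ.X k t) = ∫⁻ t in Ioc b (b + Γ.L k), f (Γ.X k t) := by
  have : VAddInvariantMeasure (AddSubgroup.zmultiples (Γ.L k)) ℝ volume :=
    ⟨fun c s _ => measure_preimage_add _ _ _⟩
  refine IsAddFundamentalDomain.setLIntegral_eq (G := AddSubgroup.zmultiples (Γ.L k))
    (isAddFundamentalDomain_Ioc (Γ.L_pos k) a) (isAddFundamentalDomain_Ioc (Γ.L_pos k) b) _
    fun g t => ?_
  rw [(Γ.periodic k).map_vadd_zmultiples]

theorem arcLength_singleton (x : Plane) : Γ.arcLength {x} = 0 := by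
  rw [arcLength_apply Γ (measurableSet_singleton x)]
  refine Finset.sum_eq_zero fun k _ => ?_
  have hsub : {t ∈ Ioc 0 (Γ.L k) | Γ.X k t ∈ ({x} : Set Plane)} ⊆
      {t ∈ Ico 0 (Γ.L k) | Γ.X k t = x} ∪ {Γ.L k} := by
    rintro t ⟨ht, hx⟩
    rcases ht.2.eq_or_lt with h | h
    · exact Or.inr h
    · exact Or.inl ⟨⟨ht.1.le, h⟩, hx⟩
  refine measure_mono_null hsub (measure_union_null (Set.Subsingleton.measure_zero ?_ _)
    Real.volume_singleton)
  intro t ht u hu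
  exact Γ.simple k ht.1 hu.1 (ht.2.trans hu.2.symm)

instance : NullSingletonClass Γ.arcLength := ⟨Γ.arcLength_singleton⟩

theorem X_mem_frontier (k : Fin Γ.m) (t : ℝ) : Γ.X k t ∈ frontier ω := by
  rw [Γ.frontier_eq]; exact mem_iUnion.2 ⟨k, mem_range_self t⟩

theorem ae_mem_frontier : ∀ᵐ x ∂Γ.arcLength, x ∈ frontier ω := by
  change Γ.arcLength (frontier ω)ᶜ = 0
  rw [arcLength_apply Γ isClosed_frontier.measurableSet.compl]
  refine Finset.sum_eq_zero fun k _ => ?_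
  simp [Γ.X_mem_frontier]

/-- The boundary is upper Ahlfors regular: the length of its part in a bounded set is at most a
multiple of the diameter of the set. -/
theorem exists_arcLength_le_diam :
    ∃ C > 0, ∀ A : Set Plane, MeasurableSet A → Bornology.IsBounded A →
      Γ.arcLength A ≤ ENNReal.ofReal (C * Metric.diam A) := by
  obtain ⟨κ, hκ, H⟩ := Γ.exists_chord_arc
  refine ⟨Γ.m * (4 / κ) + 1, by positivity, fun A hA hb => ?_⟩
  set d := Metric.diam A / κ with hd
  have hd0 : 0 ≤ d := div_nonneg Metric.diam_nonneg hκ.le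
  have key : ∀ k, volume {t ∈ Ioc 0 (Γ.L k) | Γ.X k t ∈ A} ≤ ENNReal.ofReal (4 * d) := by
    intro k
    rcases {t ∈ Ioc 0 (Γ.L k) | Γ.X k t ∈ A}.eq_empty_or_nonempty with he | ⟨t₀, ht₀, hA₀⟩
    · rw [he, measure_empty]; exact zero_le
    have hsub : {t ∈ Ioc 0 (Γ.L k) | Γ.X k t ∈ A} ⊆
        Icc (t₀ - d) (t₀ + d) ∪ (Icc 0 (t₀ + d - Γ.L k) ∪ Icc (t₀ - d + Γ.L k) (Γ.L k)) := by
      rintro t ⟨ht, htA⟩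
      have hdist : ∀ u v : ℝ, u ∈ Ioc 0 (Γ.L k) → v ∈ Ioc 0 (Γ.L k) → Γ.X k u ∈ A → Γ.X k v ∈ A →
          u ≤ v → v - u ≤ d ∨ Γ.L k - (v - u) ≤ d := by
        intro u v hu hv huA hvA huv
        have h1 := H k u (v - u) ⟨by linarith, by linarith [hu.1, hv.2]⟩
        rw [add_sub_cancel, ← dist_eq_norm] at h1
        have h2 := h1.trans (Metric.dist_le_diam_of_mem hb hvA huA)
        have h3 : min (v - u) (Γ.L k - (v - u)) ≤ d := by rw [hd, le_div_iff₀ hκ]; linarith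
        exact min_le_iff.1 h3
      rcases le_total t t₀ with h | h
      · rcases hdist t t₀ ht ht₀ htA hA₀ h with h' | h'
        · exact Or.inl ⟨by linarith, by linarith⟩
        · exact Or.inr (Or.inl ⟨ht.1.le, by linarith⟩)
      · rcases hdist t₀ t ht₀ ht hA₀ htA h with h' | h'
        · exact Or.inl ⟨by linarith, by linarith⟩
        · exact Or.inr (Or.inr ⟨by linarith, ht.2⟩)
    refine (measure_mono hsub).trans ((measure_union_le _ _).trans
      ((add_le_add le_rfl (measure_union_le _ _)).trans ?_))
    simp only [Real.volume_Icc]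
    calc _ ≤ ENNReal.ofReal (2 * d) + (ENNReal.ofReal d + ENNReal.ofReal d) := by
          gcongr <;> linarith [ht₀.1, ht₀.2]
      _ = _ := by
          rw [← ENNReal.ofReal_add hd0 hd0, ← ENNReal.ofReal_add (by linarith) (by linarith)]
          congr 1; ring
  rw [arcLength_apply Γ hA]
  calc _ ≤ ∑ _k : Fin Γ.m, ENNReal.ofReal (4 * d) := Finset.sum_le_sum fun k _ => key k
    _ = ENNReal.ofReal (Γ.m * (4 * d)) := by
        rw [Finset.sum_const, Finset.card_univ, Fintype.card_fin, nsmul_eq_mul,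
          ← ENNReal.ofReal_natCast, ← ENNReal.ofReal_mul (Nat.cast_nonneg _)]
    _ ≤ _ := by
        apply ENNReal.ofReal_le_ofReal
        have : Γ.m * (4 * d) = Γ.m * (4 / κ) * Metric.diam A := by rw [hd]; field_simp
        rw [this]
        nlinarith [Metric.diam_nonneg (s := A)]

end SmoothBoundary

/-! ### Arcs of a subdivision -/

namespace Subdivision

variable {ω : Set Plane} {Γ : SmoothBoundary ω} (S : Subdivision Γ)

theorem isCompact_arc (i : Fin S.N) : IsCompact (S.arc i) :=
  isCompact_Icc.image (Γ.continuous_X _)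

theorem measurableSet_arc (i : Fin S.N) : MeasurableSet (S.arc i) :=
  (S.isCompact_arc i).isClosed.measurableSet

theorem length_pos (i : Fin S.N) : 0 < S.length i := sub_pos.2 (S.lt i)

theorem length_le (i : Fin S.N) : S.length i ≤ Γ.L (S.comp i) := by
  have := S.le_period i
  rw [length]; linarith

/-- In the period that starts at the initial parameter of an arc, the points of the arc are, up to
one parameter, those between the initial and the final parameter. -/
theorem X_mem_arc_iff (i : Fin S.N) {t : ℝ}
    (ht : t ∈ Ioo (S.a i) (S.a i + Γ.L (S.comp i))) :
    Γ.X (S.comp i) t ∈ S.arc i ↔ t ∈ Ioc (S.a i) (S.b i) := by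
  constructor
  · rintro ⟨u, hu, he⟩
    refine ⟨ht.1, ?_⟩
    by_contra! h
    have := S.le_period i
    refine Γ.X_add_ne (S.comp i) u (u := t - u) ⟨by linarith [hu.2], ?_⟩ ?_
    · linarith [ht.2, hu.1]
    · rw [add_sub_cancel, he]
  · exact fun h => ⟨t, ⟨h.1.le, h.2⟩, rfl⟩

theorem setLIntegral_arc (i : Fin S.N) {f : Plane → ℝ≥0∞} (hf : Measurable f) :
    ∫⁻ x in S.arc i, f x ∂Γ.arcLength = ∫⁻ t in Ioc (S.a i) (S.b i), f (Γ.X (S.comp i) t) := by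
  rw [← lintegral_indicator (S.measurableSet_arc i),
    Γ.lintegral_arcLength (hf.indicator (S.measurableSet_arc i)),
    Finset.sum_eq_single (S.comp i)]
  · have := Γ.setLIntegral_period (S.comp i) ((S.arc i).indicator f) 0 (S.a i)
    rw [zero_add] at this
    rw [this, ← Ioc_union_Ioc_eq_Ioc (S.lt i).le (S.le_period i),
      lintegral_union measurableSet_Ioc (by
        rw [disjoint_left]; exact fun t h1 h2 => absurd h1.2 (not_le.2 h2.1))]
    have h1 : ∫⁻ t in Ioc (S.a i) (S.b i), (S.arc i).indicator f (Γ.X (S.comp i) t) =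
        ∫⁻ t in Ioc (S.a i) (S.b i), f (Γ.X (S.comp i) t) :=
      setLIntegral_congr_fun measurableSet_Ioc fun t ht =>
        indicator_of_mem (show Γ.X (S.comp i) t ∈ S.arc i from ⟨t, ⟨ht.1.le, ht.2⟩, rfl⟩) f
    have h2 : ∫⁻ t in Ioc (S.b i) (S.a i + Γ.L (S.comp i)),
        (S.arc i).indicator f (Γ.X (S.comp i) t) = 0 := by
      rw [← restrict_Ioo_eq_restrict_Ioc]
      rw [setLIntegral_congr_fun (g := fun _ => 0) measurableSet_Ioo, lintegral_zero]
      intro t ht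
      refine indicator_of_notMem (fun h => ?_) f
      have := (S.X_mem_arc_iff i ⟨(S.lt i).trans ht.1, ht.2⟩).1 h
      exact absurd this.2 (not_le.2 ht.1)
    rw [h1, h2, add_zero]
  · intro k _ hk
    rw [setLIntegral_congr_fun (g := fun _ => 0) measurableSet_Ioc, lintegral_zero]
    intro t _
    refine indicator_of_notMem (fun h => ?_) f
    obtain ⟨u, -, hu⟩ := h
    exact disjoint_left.1 (Γ.disjoint k (S.comp i) hk) (mem_range_self t) (hu ▸ mem_range_self u)
  · exact fun h => absurd (Finset.mem_univ _) h

/-- Almost every point of the boundary lies on exactly one arc. -/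
theorem ae_existsUnique_arc : ∀ᵐ x ∂Γ.arcLength, ∃! i, x ∈ S.arc i := by
  have hfin : (range (fun i => Γ.X (S.comp i) (S.a i)) ∪
      range (fun i => Γ.X (S.comp i) (S.b i))).Finite :=
    (finite_range _).union (finite_range _)
  have hnull := hfin.measure_zero Γ.arcLength
  filter_upwards [Γ.ae_mem_frontier, measure_eq_zero_iff_ae_notMem.1 hnull] with x hx hx'
  have hmem : ∀ i, x ∈ S.arc i → x ∈ Γ.X (S.comp i) '' Ioo (S.a i) (S.b i) := by
    rintro i ⟨t, ht, rfl⟩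
    refine ⟨t, ⟨lt_of_le_of_ne ht.1 ?_, lt_of_le_of_ne ht.2 ?_⟩, rfl⟩
    · rintro rfl; exact hx' (Or.inl ⟨i, rfl⟩)
    · rintro rfl; exact hx' (Or.inr ⟨i, rfl⟩)
  rw [← S.cover] at hx
  obtain ⟨i, hi⟩ := mem_iUnion.1 hx
  refine ⟨i, hi, fun j hj => ?_⟩
  by_contra hne
  exact disjoint_left.1 (S.nonoverlap j i hne) (hmem j hj) (hmem i hi)

end Subdivision

/-! ### One-dimensional integrals of powers -/

theorem setLIntegral_comp_sub_left (f : ℝ → ℝ≥0∞) {A B : Set ℝ} (hA : MeasurableSet A)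
    (hB : MeasurableSet B) (c : ℝ) (h : ∀ t ∈ A, c - t ∈ B) :
    ∫⁻ t in A, f (c - t) ≤ ∫⁻ z in B, f z := by
  rw [← lintegral_indicator hA, ← lintegral_indicator hB, ← lintegral_sub_left_eq_self (B.indicator _) c]
  refine lintegral_mono fun t => ?_
  by_cases ht : t ∈ A
  · rw [indicator_of_mem ht, indicator_of_mem (h t ht)]
  · rw [indicator_of_notMem ht]; exact zero_le

theorem setLIntegral_comp_sub_right (f : ℝ → ℝ≥0∞) {A B : Set ℝ} (hA : MeasurableSet A)
    (hB : MeasurableSet B) (c : ℝ) (h : ∀ t ∈ A, t - c ∈ B) :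
    ∫⁻ t in A, f (t - c) ≤ ∫⁻ z in B, f z := by
  rw [← lintegral_indicator hA, ← lintegral_indicator hB, ← lintegral_sub_right_eq_self (B.indicator _) c]
  refine lintegral_mono fun t => ?_
  by_cases ht : t ∈ A
  · rw [indicator_of_mem ht, indicator_of_mem (h t ht)]
  · rw [indicator_of_notMem ht]; exact zero_le

section Kernels

variable {p : ℝ}

theorem lintegral_Ioi_rpow_neg (hp : 1 < p) {ρ : ℝ} (hρ : 0 < ρ) :
    ∫⁻ z in Ioi ρ, ENNReal.ofReal (z ^ (-p)) = ENNReal.ofReal (ρ ^ (1 - p) / (p - 1)) := by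
  rw [← ofReal_integral_eq_lintegral_ofReal (integrableOn_Ioi_rpow_of_lt (by linarith) hρ),
    integral_Ioi_rpow_of_lt (by linarith) hρ]
  · congr 1
    rw [show -p + 1 = -(p - 1) by ring, neg_div_neg_eq, show -(p - 1) = 1 - p by ring]
  · filter_upwards [ae_restrict_mem measurableSet_Ioi] with z hz
    exact Real.rpow_nonneg (hρ.trans hz).le _

theorem lintegral_Icc_rpow_one_sub (hp : p < 2) {l : ℝ} (hl : 0 ≤ l) :
    ∫⁻ z in Icc 0 l, ENNReal.ofReal (z ^ (1 - p)) = ENNReal.ofReal (l ^ (2 - p) / (2 - p)) := by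
  rw [← restrict_Ioc_eq_restrict_Icc, ← ofReal_integral_eq_lintegral_ofReal,
    ← intervalIntegral.integral_of_le hl, integral_rpow (Or.inl (by linarith))]
  · rw [show 1 - p + 1 = 2 - p by ring, Real.zero_rpow (by linarith), sub_zero]
  · exact (intervalIntegrable_iff_integrableOn_Ioc_of_le hl).1
      (intervalIntegral.intervalIntegrable_rpow' (by linarith))
  · filter_upwards [ae_restrict_mem measurableSet_Ioc] with z hz
    exact Real.rpow_nonneg hz.1.le _

theorem lintegral_Ioc_sub_left_rpow_le (hp : p < 2) {a b : ℝ} (hab : a ≤ b) :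
    ∫⁻ t in Ioc a b, ENNReal.ofReal ((b - t) ^ (1 - p)) ≤
      ENNReal.ofReal ((b - a) ^ (2 - p) / (2 - p)) := by
  rw [← lintegral_Icc_rpow_one_sub hp (sub_nonneg.2 hab)]
  exact setLIntegral_comp_sub_left (fun z => ENNReal.ofReal (z ^ (1 - p))) measurableSet_Ioc
    measurableSet_Icc b fun t ht => ⟨by linarith [ht.2], by linarith [ht.1]⟩

theorem lintegral_Ioc_sub_right_rpow_le (hp : p < 2) {a b : ℝ} (hab : a ≤ b) :
    ∫⁻ t in Ioc a b, ENNReal.ofReal ((t - a) ^ (1 - p)) ≤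
      ENNReal.ofReal ((b - a) ^ (2 - p) / (2 - p)) := by
  rw [← lintegral_Icc_rpow_one_sub hp (sub_nonneg.2 hab)]
  exact setLIntegral_comp_sub_right (fun z => ENNReal.ofReal (z ^ (1 - p))) measurableSet_Ioc
    measurableSet_Icc a fun t ht => ⟨by linarith [ht.1], by linarith [ht.2]⟩

theorem lintegral_sub_right_rpow_neg_le (hp : 1 < p) {t b : ℝ} (h : t < b) {A : Set ℝ}
    (hA : MeasurableSet A) (hAb : A ⊆ Ioi b) :
    ∫⁻ u in A, ENNReal.ofReal ((u - t) ^ (-p)) ≤ ENNReal.ofReal ((b - t) ^ (1 - p) / (p - 1)) := by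
  rw [← lintegral_Ioi_rpow_neg hp (sub_pos.2 h)]
  exact setLIntegral_comp_sub_right (fun z => ENNReal.ofReal (z ^ (-p))) hA
    measurableSet_Ioi t fun u hu => sub_lt_sub_right (hAb hu) t

theorem lintegral_sub_left_rpow_neg_le (hp : 1 < p) {t a : ℝ} (h : a < t) {A : Set ℝ}
    (hA : MeasurableSet A) (hAa : A ⊆ Iio a) :
    ∫⁻ u in A, ENNReal.ofReal ((t - u) ^ (-p)) ≤ ENNReal.ofReal ((t - a) ^ (1 - p) / (p - 1)) := by
  rw [← lintegral_Ioi_rpow_neg hp (sub_pos.2 h)]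
  exact setLIntegral_comp_sub_left (fun z => ENNReal.ofReal (z ^ (-p))) hA
    measurableSet_Ioi t fun u hu => sub_lt_sub_left (hAa hu) t

/-! ### Integrals of the Gagliardo kernel over arcs -/

/-- The kernel `|x - y| ^ (-p)` of the Gagliardo seminorm, with `p = 1 + 2 r`. -/
noncomputable def kernel (p : ℝ) (x y : Plane) : ℝ≥0∞ := ENNReal.ofReal (‖x - y‖ ^ (-p))

theorem measurable_kernel (p : ℝ) : Measurable fun q : Plane × Plane => kernel p q.1 q.2 := by
  unfold kernel; fun_prop

theorem kernel_comm (p : ℝ) (x y : Plane) : kernel p x y = kernel p y x := by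
  rw [kernel, kernel, norm_sub_rev]

theorem rpow_neg_le_add {κ α β n : ℝ} (hp : 0 ≤ p) (hκ : 0 < κ) (hα : 0 < α) (hβ : 0 < β)
    (h : κ * min α β ≤ n) : n ^ (-p) ≤ κ ^ (-p) * (α ^ (-p) + β ^ (-p)) := by
  have hm : 0 < min α β := lt_min hα hβ
  refine (Real.rpow_le_rpow_of_nonpos (by positivity) h (neg_nonpos.2 hp)).trans ?_
  rw [Real.mul_rpow hκ.le hm.le]
  refine mul_le_mul_of_nonneg_left ?_ (by positivity)
  have := Real.rpow_nonneg hα.le (-p)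
  have := Real.rpow_nonneg hβ.le (-p)
  rcases min_cases α β with ⟨h, -⟩ | ⟨h, -⟩ <;> rw [h] <;> linarith

variable {ω : Set Plane} {Γ : SmoothBoundary ω}

/-- The kernel blows up at the endpoints of an arc only like the power `1 - p > -1` of the distance
to them once it is integrated over the rest of the same boundary component. -/
theorem lintegral_kernel_rest_of_component_le {κ : ℝ} (hκ : 0 < κ)
    (H : ∀ k, ∀ t u : ℝ, u ∈ Icc 0 (Γ.L k) →
      κ * min u (Γ.L k - u) ≤ ‖Γ.X k (t + u) - Γ.X k t‖)
    (hp : 1 < p) (k : Fin Γ.m) {a b t : ℝ} (hat : a < t) (htb : t < b) :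
    ∫⁻ u in Ioc b (a + Γ.L k), kernel p (Γ.X k t) (Γ.X k u) ≤
      ENNReal.ofReal (κ ^ (-p) / (p - 1)) *
        (ENNReal.ofReal ((b - t) ^ (1 - p)) + ENNReal.ofReal ((t - a) ^ (1 - p))) := by
  have hp1 : 0 < p - 1 := by linarith
  rw [← restrict_Ioo_eq_restrict_Ioc]
  have hpt : ∀ u ∈ Ioo b (a + Γ.L k), kernel p (Γ.X k t) (Γ.X k u) ≤
      ENNReal.ofReal (κ ^ (-p)) *
        (ENNReal.ofReal ((u - t) ^ (-p)) + ENNReal.ofReal ((t + Γ.L k - u) ^ (-p))) := by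
    intro u hu
    have h1 : 0 < u - t := by linarith [hu.1]
    have h2 : 0 < t + Γ.L k - u := by linarith [hu.2]
    rw [kernel_comm, kernel, ← ENNReal.ofReal_add (by positivity) (by positivity),
      ← ENNReal.ofReal_mul (by positivity)]
    refine ENNReal.ofReal_le_ofReal (rpow_neg_le_add (by linarith) hκ h1 h2 ?_)
    have := H k t (u - t) ⟨h1.le, by linarith⟩
    rwa [add_sub_cancel, show Γ.L k - (u - t) = t + Γ.L k - u by ring] at this
  refine (setLIntegral_mono' measurableSet_Ioo hpt).trans ?_
  rw [lintegral_const_mul' _ _ ENNReal.ofReal_ne_top, lintegral_add_left (by fun_prop)]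
  have e1 := lintegral_sub_right_rpow_neg_le hp htb (measurableSet_Ioo (a := b) (b := a + Γ.L k))
    fun u hu => hu.1
  have e2 := lintegral_sub_left_rpow_neg_le hp (t := t + Γ.L k) (a := a + Γ.L k) (by linarith)
    (measurableSet_Ioo (a := b) (b := a + Γ.L k)) fun u hu => hu.2
  rw [add_sub_add_right_eq_sub] at e2
  refine (mul_le_mul_right (add_le_add e1 e2) _).trans_eq ?_
  rw [div_eq_inv_mul, div_eq_inv_mul, ENNReal.ofReal_mul (by positivity),
    ENNReal.ofReal_mul (by positivity), ← mul_add, ← mul_assoc, div_eq_mul_inv,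
    ENNReal.ofReal_mul (by positivity)]

/-- The interaction of an arc with its complement is at most of the order of the power
`2 - p = 1 - 2 r` of its length. This is where `r < 1 / 2` matters: characteristic functions of
arcs then have finite Gagliardo seminorm. -/
theorem exists_lintegral_kernel_arc_compl_le (Γ : SmoothBoundary ω) (hp : 1 < p) (hp2 : p < 2) :
    ∃ C > 0, ∀ (S : Subdivision Γ) (i : Fin S.N),
      ∫⁻ x in S.arc i, ∫⁻ y in (S.arc i)ᶜ, kernel p x y ∂Γ.arcLength ∂Γ.arcLength ≤
        ENNReal.ofReal (C * S.length i ^ (2 - p)) := by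
  obtain ⟨κ, hκ, H⟩ := Γ.exists_chord_arc
  obtain ⟨δ, hδ, Hδ⟩ := Γ.exists_dist_components
  have hp1 : 0 < p - 1 := by linarith
  have hp2' : 0 < 2 - p := by linarith
  set Λ := Γ.totalLength
  have hΛ : 0 ≤ Λ := Γ.totalLength_nonneg
  refine ⟨κ ^ (-p) / (p - 1) * (2 / (2 - p)) + δ ^ (-p) * Λ * Λ ^ (p - 1), by positivity,
    fun S i => ?_⟩
  set k := S.comp i
  set a := S.a i
  set b := S.b i
  have hab : a < b := S.lt i
  have hl : 0 < b - a := sub_pos.2 hab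
  have hK := measurable_kernel p
  have hA := S.measurableSet_arc i
  rw [S.setLIntegral_arc i hK.lintegral_prod_right', ← restrict_Ioo_eq_restrict_Ioc]
  -- the integral over the rest of the same component and over the other components
  have hinner : ∀ t ∈ Ioo a b, ∫⁻ y in (S.arc i)ᶜ, kernel p (Γ.X k t) y ∂Γ.arcLength ≤
      ENNReal.ofReal (κ ^ (-p) / (p - 1)) *
        (ENNReal.ofReal ((b - t) ^ (1 - p)) + ENNReal.ofReal ((t - a) ^ (1 - p))) +
      ENNReal.ofReal (δ ^ (-p) * Λ) := by
    intro t ht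
    have hm : Measurable fun y => kernel p (Γ.X k t) y := hK.of_uncurry_left
    rw [← lintegral_indicator hA.compl, Γ.lintegral_arcLength (hm.indicator hA.compl),
      ← Finset.add_sum_erase _ _ (Finset.mem_univ k)]
    refine add_le_add ?_ ?_
    · refine le_trans (le_of_eq ?_)
        (lintegral_kernel_rest_of_component_le hκ H hp k ht.1 ht.2)
      have := Γ.setLIntegral_period k ((S.arc i)ᶜ.indicator fun y => kernel p (Γ.X k t) y) 0 a
      rw [zero_add] at this
      rw [this, ← Ioc_union_Ioc_eq_Ioc hab.le (S.le_period i),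
        lintegral_union measurableSet_Ioc (by
          rw [disjoint_left]; exact fun t h1 h2 => absurd h1.2 (not_le.2 h2.1))]
      have h1 : ∫⁻ u in Ioc a b,
          (S.arc i)ᶜ.indicator (fun y => kernel p (Γ.X k t) y) (Γ.X k u) = 0 := by
        rw [setLIntegral_congr_fun (g := fun _ => 0) measurableSet_Ioc, lintegral_zero]
        intro u hu
        have hmem : Γ.X k u ∈ S.arc i := ⟨u, ⟨hu.1.le, hu.2⟩, rfl⟩
        exact indicator_of_notMem (notMem_compl_iff.2 hmem) _
      rw [h1, zero_add, ← restrict_Ioo_eq_restrict_Ioc]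
      refine setLIntegral_congr_fun measurableSet_Ioo fun u hu => indicator_of_mem ?_ _
      intro h
      have := (S.X_mem_arc_iff i ⟨hab.trans hu.1, hu.2⟩).1 h
      exact absurd this.2 (not_le.2 hu.1)
    · calc _ ≤ ∑ j ∈ Finset.univ.erase k, ENNReal.ofReal (δ ^ (-p) * Γ.L j) := by
            refine Finset.sum_le_sum fun j hj => ?_
            have hjk : k ≠ j := (Finset.ne_of_mem_erase hj).symm
            calc _ ≤ ∫⁻ _ in Ioc 0 (Γ.L j), ENNReal.ofReal (δ ^ (-p)) := by
                  refine lintegral_mono fun u => (indicator_le_self _ _ _).trans ?_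
                  exact ENNReal.ofReal_le_ofReal (Real.rpow_le_rpow_of_nonpos hδ
                    (Hδ k j hjk t u) (by linarith))
              _ = _ := by
                  rw [setLIntegral_const, Real.volume_Ioc, sub_zero,
                    ENNReal.ofReal_mul (by positivity)]
        _ ≤ ∑ j, ENNReal.ofReal (δ ^ (-p) * Γ.L j) :=
            Finset.sum_le_sum_of_subset (Finset.erase_subset _ _)
        _ = _ := by
            rw [← ENNReal.ofReal_sum_of_nonneg
              (fun j _ => mul_nonneg (by positivity) (Γ.L_pos j).le), ← Finset.mul_sum]
            rfl
  refine (setLIntegral_mono' measurableSet_Ioo hinner).trans ?_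
  rw [restrict_Ioo_eq_restrict_Ioc, lintegral_add_right _ measurable_const,
    lintegral_const_mul' _ _ ENNReal.ofReal_ne_top, lintegral_add_left (by fun_prop),
    setLIntegral_const, Real.volume_Ioc]
  have hX : (b - a) ≤ Λ ^ (p - 1) * (b - a) ^ (2 - p) := by
    have h1 : b - a ≤ Λ := (S.length_le i).trans (Γ.L_le_totalLength k)
    calc b - a = (b - a) ^ (p - 1) * (b - a) ^ (2 - p) := by
          rw [← Real.rpow_add hl, show p - 1 + (2 - p) = 1 by ring, Real.rpow_one]
      _ ≤ _ := by gcongr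
  calc _ ≤ ENNReal.ofReal (κ ^ (-p) / (p - 1)) *
          (ENNReal.ofReal ((b - a) ^ (2 - p) / (2 - p)) +
            ENNReal.ofReal ((b - a) ^ (2 - p) / (2 - p))) +
          ENNReal.ofReal (δ ^ (-p) * Λ) * ENNReal.ofReal (b - a) := by
        gcongr
        · exact lintegral_Ioc_sub_left_rpow_le hp2 hab.le
        · exact lintegral_Ioc_sub_right_rpow_le hp2 hab.le
    _ = ENNReal.ofReal (κ ^ (-p) / (p - 1) *
          ((b - a) ^ (2 - p) / (2 - p) + (b - a) ^ (2 - p) / (2 - p)) +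
          δ ^ (-p) * Λ * (b - a)) := by
        rw [← ENNReal.ofReal_add (by positivity) (by positivity),
          ← ENNReal.ofReal_mul (by positivity), ← ENNReal.ofReal_mul (by positivity),
          ← ENNReal.ofReal_add (by positivity) (by positivity)]
    _ ≤ _ := by
        refine ENNReal.ofReal_le_ofReal ?_
        have h3 : δ ^ (-p) * Λ * (b - a) ≤ δ ^ (-p) * Λ * (Λ ^ (p - 1) * (b - a) ^ (2 - p)) := by
          gcongr
        have h4 : S.length i = b - a := rfl
        rw [h4]
        refine (add_le_add le_rfl h3).trans_eq ?_
        ring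

theorem abs_mul_rpow_neg_le {κ Δ l n : ℝ} (hp : 0 ≤ p) (hκ : 0 < κ) (hΔ : 0 < Δ) (hl : Δ < l)
    (h : κ * min Δ (l - Δ) ≤ n) :
    Δ * n ^ (-p) ≤ κ ^ (-p) * (Δ ^ (1 - p) + l * (l - Δ) ^ (-p)) := by
  have h1 := rpow_neg_le_add hp hκ hΔ (sub_pos.2 hl) h
  have h2 : Δ * Δ ^ (-p) = Δ ^ (1 - p) := by
    rw [sub_eq_add_neg, Real.rpow_add hΔ, Real.rpow_one]
  have h3 : 0 ≤ (l - Δ) ^ (-p) := Real.rpow_nonneg (sub_pos.2 hl).le _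
  have h4 : 0 ≤ κ ^ (-p) := by positivity
  calc _ ≤ Δ * (κ ^ (-p) * (Δ ^ (-p) + (l - Δ) ^ (-p))) := mul_le_mul_of_nonneg_left h1 hΔ.le
    _ = κ ^ (-p) * (Δ * Δ ^ (-p) + Δ * (l - Δ) ^ (-p)) := by ring
    _ ≤ _ := by rw [h2]; gcongr

/-- The inner integral of the kernel, weighted by the parameter distance. The second term of the
bound is due to arcs that nearly are closed curves: their endpoints are close in the plane. -/
theorem lintegral_abs_mul_kernel_le {κ : ℝ} (hκ : 0 < κ)
    (H : ∀ k, ∀ t u : ℝ, u ∈ Icc 0 (Γ.L k) →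
      κ * min u (Γ.L k - u) ≤ ‖Γ.X k (t + u) - Γ.X k t‖)
    (hp : 1 < p) (hp2 : p < 2) (k : Fin Γ.m) {a b t : ℝ} (hat : a < t) (htb : t < b)
    (hL : b ≤ a + Γ.L k) :
    ∫⁻ u in Ioc a b, ENNReal.ofReal |t - u| * kernel p (Γ.X k t) (Γ.X k u) ≤
      ENNReal.ofReal (κ ^ (-p)) * (ENNReal.ofReal (2 * (b - a) ^ (2 - p) / (2 - p)) +
        ENNReal.ofReal ((b - a) / (p - 1)) *
          (ENNReal.ofReal ((b - t) ^ (1 - p)) + ENNReal.ofReal ((t - a) ^ (1 - p)))) := by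
  have hp1 : 0 < p - 1 := by linarith
  have hp2' : 0 < 2 - p := by linarith
  have hl : 0 < b - a := by linarith
  have hmin : ∀ Δ : ℝ, min Δ (b - a - Δ) ≤ min Δ (Γ.L k - Δ) := fun Δ =>
    min_le_min_left _ (by linarith)
  -- parameters after `t`
  have hR : ∀ u ∈ Ioo t b, ENNReal.ofReal |t - u| * kernel p (Γ.X k t) (Γ.X k u) ≤
      ENNReal.ofReal (κ ^ (-p)) * (ENNReal.ofReal ((u - t) ^ (1 - p)) +
        ENNReal.ofReal (b - a) * ENNReal.ofReal ((t + (b - a) - u) ^ (-p))) := by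
    intro u hu
    have h1 : 0 < u - t := by linarith [hu.1]
    have h2 : 0 < t + (b - a) - u := by linarith [hu.2]
    rw [kernel_comm, kernel, ← ENNReal.ofReal_mul (abs_nonneg _), ← ENNReal.ofReal_mul hl.le,
      ← ENNReal.ofReal_add (by positivity) (by positivity), ← ENNReal.ofReal_mul (by positivity),
      abs_sub_comm, abs_of_pos h1]
    refine ENNReal.ofReal_le_ofReal ?_
    have h3 := H k t (u - t) ⟨h1.le, by linarith⟩
    rw [add_sub_cancel] at h3
    have h4 := abs_mul_rpow_neg_le (p := p) (by linarith) hκ h1 (l := b - a) (by linarith)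
      ((mul_le_mul_of_nonneg_left (hmin (u - t)) hκ.le).trans h3)
    rwa [show b - a - (u - t) = t + (b - a) - u by ring] at h4
  -- parameters before `t`
  have hLft : ∀ u ∈ Ioo a t, ENNReal.ofReal |t - u| * kernel p (Γ.X k t) (Γ.X k u) ≤
      ENNReal.ofReal (κ ^ (-p)) * (ENNReal.ofReal ((t - u) ^ (1 - p)) +
        ENNReal.ofReal (b - a) * ENNReal.ofReal ((u - (t - (b - a))) ^ (-p))) := by
    intro u hu
    have h1 : 0 < t - u := by linarith [hu.2]
    have h2 : 0 < u - (t - (b - a)) := by linarith [hu.1]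
    rw [kernel, ← ENNReal.ofReal_mul (abs_nonneg _), ← ENNReal.ofReal_mul hl.le,
      ← ENNReal.ofReal_add (by positivity) (by positivity), ← ENNReal.ofReal_mul (by positivity),
      abs_of_pos h1]
    refine ENNReal.ofReal_le_ofReal ?_
    have h3 := H k u (t - u) ⟨h1.le, by linarith⟩
    rw [add_sub_cancel] at h3
    have h4 := abs_mul_rpow_neg_le (p := p) (by linarith) hκ h1 (l := b - a) (by linarith)
      ((mul_le_mul_of_nonneg_left (hmin (t - u)) hκ.le).trans h3)
    rwa [show b - a - (t - u) = u - (t - (b - a)) by ring] at h4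
  have iR : ∫⁻ u in Ioc t b, ENNReal.ofReal |t - u| * kernel p (Γ.X k t) (Γ.X k u) ≤
      ENNReal.ofReal (κ ^ (-p)) * (ENNReal.ofReal ((b - a) ^ (2 - p) / (2 - p)) +
        ENNReal.ofReal (b - a) * ENNReal.ofReal ((t - a) ^ (1 - p) / (p - 1))) := by
    rw [← restrict_Ioo_eq_restrict_Ioc]
    refine (setLIntegral_mono' measurableSet_Ioo hR).trans ?_
    rw [lintegral_const_mul' _ _ ENNReal.ofReal_ne_top, lintegral_add_left (by fun_prop),
      lintegral_const_mul' _ _ ENNReal.ofReal_ne_top]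
    have e2 := lintegral_sub_left_rpow_neg_le hp (t := t + (b - a)) (a := b) (by linarith)
      (measurableSet_Ioo (a := t) (b := b)) fun u hu => hu.2
    rw [show t + (b - a) - b = t - a by ring] at e2
    gcongr
    rw [restrict_Ioo_eq_restrict_Ioc]
    refine (lintegral_Ioc_sub_right_rpow_le hp2 htb.le).trans (ENNReal.ofReal_le_ofReal ?_)
    gcongr
  have iL : ∫⁻ u in Ioc a t, ENNReal.ofReal |t - u| * kernel p (Γ.X k t) (Γ.X k u) ≤
      ENNReal.ofReal (κ ^ (-p)) * (ENNReal.ofReal ((b - a) ^ (2 - p) / (2 - p)) +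
        ENNReal.ofReal (b - a) * ENNReal.ofReal ((b - t) ^ (1 - p) / (p - 1))) := by
    rw [← restrict_Ioo_eq_restrict_Ioc]
    refine (setLIntegral_mono' measurableSet_Ioo hLft).trans ?_
    rw [lintegral_const_mul' _ _ ENNReal.ofReal_ne_top, lintegral_add_left (by fun_prop),
      lintegral_const_mul' _ _ ENNReal.ofReal_ne_top]
    have e2 := lintegral_sub_right_rpow_neg_le hp (t := t - (b - a)) (b := a) (by linarith)
      (measurableSet_Ioo (a := a) (b := t)) fun u hu => hu.1
    rw [show a - (t - (b - a)) = b - t by ring] at e2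
    gcongr
    rw [restrict_Ioo_eq_restrict_Ioc]
    refine (lintegral_Ioc_sub_left_rpow_le hp2 hat.le).trans (ENNReal.ofReal_le_ofReal ?_)
    gcongr
  rw [← Ioc_union_Ioc_eq_Ioc hat.le htb.le, lintegral_union measurableSet_Ioc (by
      rw [disjoint_left]; exact fun t h1 h2 => absurd h1.2 (not_le.2 h2.1))]
  refine (add_le_add iL iR).trans_eq ?_
  have hbt : 0 < b - t := by linarith
  have hta : 0 < t - a := by linarith
  simp only [← ENNReal.ofReal_mul hl.le]
  rw [← ENNReal.ofReal_add (by positivity) (by positivity),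
    ← ENNReal.ofReal_add (by positivity) (by positivity),
    ← ENNReal.ofReal_add (by positivity) (by positivity),
    ← ENNReal.ofReal_mul (by positivity), ← ENNReal.ofReal_mul (by positivity),
    ← ENNReal.ofReal_mul (by positivity), ← ENNReal.ofReal_add (by positivity) (by positivity),
    ← ENNReal.ofReal_add (by positivity) (by positivity), ← ENNReal.ofReal_mul (by positivity)]
  congr 1
  ring

theorem exists_lintegral_abs_mul_kernel_le (Γ : SmoothBoundary ω) (hp : 1 < p) (hp2 : p < 2) :
    ∃ C > 0, ∀ (k : Fin Γ.m) (a b : ℝ), a < b → b ≤ a + Γ.L k →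
      ∫⁻ t in Ioc a b, ∫⁻ u in Ioc a b,
        ENNReal.ofReal |t - u| * kernel p (Γ.X k t) (Γ.X k u) ≤
        ENNReal.ofReal (C * (b - a) ^ (3 - p)) := by
  obtain ⟨κ, hκ, H⟩ := Γ.exists_chord_arc
  have hp1 : 0 < p - 1 := by linarith
  have hp2' : 0 < 2 - p := by linarith
  refine ⟨κ ^ (-p) * (2 / (2 - p) + 2 / ((p - 1) * (2 - p))), by positivity,
    fun k a b hab hL => ?_⟩
  have hl : 0 < b - a := sub_pos.2 hab
  rw [← restrict_Ioo_eq_restrict_Ioc]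
  refine (setLIntegral_mono' measurableSet_Ioo (g := fun t =>
      ENNReal.ofReal (κ ^ (-p)) * (ENNReal.ofReal (2 * (b - a) ^ (2 - p) / (2 - p)) +
        ENNReal.ofReal ((b - a) / (p - 1)) *
          (ENNReal.ofReal ((b - t) ^ (1 - p)) + ENNReal.ofReal ((t - a) ^ (1 - p)))))
      fun t ht => ?_).trans ?_
  · rw [restrict_Ioo_eq_restrict_Ioc]
    exact lintegral_abs_mul_kernel_le hκ H hp hp2 k ht.1 ht.2 hL
  rw [restrict_Ioo_eq_restrict_Ioc, lintegral_const_mul' _ _ ENNReal.ofReal_ne_top,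
    lintegral_add_left measurable_const, lintegral_const_mul' _ _ ENNReal.ofReal_ne_top,
    lintegral_add_left (by fun_prop), setLIntegral_const, Real.volume_Ioc]
  calc _ ≤ ENNReal.ofReal (κ ^ (-p)) *
          (ENNReal.ofReal (2 * (b - a) ^ (2 - p) / (2 - p)) * ENNReal.ofReal (b - a) +
          ENNReal.ofReal ((b - a) / (p - 1)) *
          (ENNReal.ofReal ((b - a) ^ (2 - p) / (2 - p)) +
            ENNReal.ofReal ((b - a) ^ (2 - p) / (2 - p)))) := by
        gcongr
        · exact lintegral_Ioc_sub_left_rpow_le hp2 hab.le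
        · exact lintegral_Ioc_sub_right_rpow_le hp2 hab.le
    _ = _ := by
        rw [← ENNReal.ofReal_add (by positivity) (by positivity),
          ← ENNReal.ofReal_mul (by positivity), ← ENNReal.ofReal_mul (by positivity),
          ← ENNReal.ofReal_add (by positivity) (by positivity),
          ← ENNReal.ofReal_mul (by positivity)]
        congr 1
        have : (b - a) ^ (3 - p) = (b - a) ^ (2 - p) * (b - a) := by
          rw [show 3 - p = 2 - p + 1 by ring, Real.rpow_add hl, Real.rpow_one]
        rw [this]
        field_simp
        ring

end Kernels

open Filter Topology

/-! ### The unit square -/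

theorem isOpen_unitSquare : IsOpen unitSquare := by
  have : unitSquare = ⋂ i : Fin 2, (fun x : Plane => x i) ⁻¹' Ioo (0 : ℝ) 1 := by
    ext x; simp [unitSquare]
  rw [this]
  exact isOpen_iInter_of_finite fun i => isOpen_Ioo.preimage (by fun_prop)

theorem convex_unitSquare : Convex ℝ unitSquare := by
  intro x hx y hy a b ha hb hab i
  have := convex_Ioo (0 : ℝ) 1 (hx i) (hy i) ha hb hab
  simpa using this

/-! ### Functions along curves through finitely many closed sets -/

/-- Finitely many sets cannot all be left eventually if their union is not. -/
theorem exists_frequently_mem_of_finite {α : Type*} {l : Filter α} [l.NeBot] {𝓕 : Set (Set α)}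
    (hfin : 𝓕.Finite) (h : ∀ᶠ x in l, ∃ K ∈ 𝓕, x ∈ K) : ∃ K ∈ 𝓕, ∃ᶠ x in l, x ∈ K := by
  by_contra! hcon
  have h1 : ∀ᶠ x in l, ∀ K ∈ 𝓕, x ∉ K :=
    (eventually_all_finite hfin).2 hcon
  obtain ⟨x, ⟨K, hK, hx⟩, hx'⟩ := (h.and h1).exists
  exact hx' K hK hx

/-- A curve that runs through finitely many closed sets stays infinitely often, just after a given
time, in one of the sets that contain its current point. -/
theorem exists_frequently_mem_right {E : Type*} [TopologicalSpace E] {𝓕 : Set (Set E)}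
    (hfin : 𝓕.Finite) (hcl : ∀ K ∈ 𝓕, IsClosed K) {c : ℝ → E} (hc : Continuous c) {t b : ℝ}
    (htb : t < b) (hcov : ∀ u ∈ Ioo t b, ∃ K ∈ 𝓕, c u ∈ K) :
    ∃ K ∈ 𝓕, c t ∈ K ∧ ∃ᶠ u in 𝓝[>] t, c u ∈ K := by
  have htend : Tendsto c (𝓝[>] t) (𝓝 (c t)) := hc.continuousAt.tendsto.mono_left inf_le_left
  have hev : ∀ᶠ x in map c (𝓝[>] t), ∃ K ∈ 𝓕, x ∈ K := by
    rw [eventually_map]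
    filter_upwards [Ioo_mem_nhdsGT htb] with u hu using hcov u hu
  obtain ⟨K, hK, hfr⟩ := exists_frequently_mem_of_finite hfin hev
  rw [frequently_map] at hfr
  exact ⟨K, hK, (hcl K hK).mem_of_frequently_of_tendsto hfr htend, hfr⟩

/-- A continuous function that is Lipschitz on each of finitely many closed pieces of a curve is
Lipschitz with the same constant. -/
theorem abs_sub_le_of_finite_closed_cover {E : Type*} [TopologicalSpace E] {𝓕 : Set (Set E)}
    (hfin : 𝓕.Finite) (hcl : ∀ K ∈ 𝓕, IsClosed K) {c : ℝ → E} (hc : Continuous c) {a b : ℝ}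
    (hab : a ≤ b) (hcov : ∀ u ∈ Icc a b, ∃ K ∈ 𝓕, c u ∈ K) {f : ℝ → ℝ}
    (hf : ContinuousOn f (Icc a b)) {M : ℝ}
    (hM : ∀ K ∈ 𝓕, ∀ t u, c t ∈ K → c u ∈ K → |f t - f u| ≤ M * |t - u|) :
    |f b - f a| ≤ M * (b - a) := by
  refine image_le_of_liminf_slope_right_le_deriv_boundary (f := fun t => |f t - f a|)
    (B := fun t => M * (t - a)) (B' := fun _ => M) ((hf.sub continuousOn_const).abs) (by simp)
    (by fun_prop) (fun x _ => ?_) (fun x hx r hr => ?_) (right_mem_Icc.2 hab)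
  · simpa using (((hasDerivAt_id x).sub_const a).const_mul M).hasDerivWithinAt
  · obtain ⟨K, hK, hxK, hfr⟩ := exists_frequently_mem_right hfin hcl hc hx.2
      fun u hu => hcov u ⟨hx.1.trans hu.1.le, hu.2.le⟩
    refine (hfr.and_eventually self_mem_nhdsWithin).mono fun z hz => ?_
    have hz' : 0 < z - x := sub_pos.2 hz.2
    rw [slope_def_field, div_lt_iff₀ hz']
    have h1 := hM K hK z x hz.1 hxK
    rw [abs_of_pos hz'] at h1
    have h2 : |f z - f a| - |f x - f a| ≤ |f z - f x| := by
      simpa using abs_sub_abs_le_abs_sub (f z - f a) (f x - f a)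
    have h3 : M * (z - x) < r * (z - x) := mul_lt_mul_of_pos_right hr hz'
    linarith

/-- The Cauchy-Schwarz inequality for the increments of a Lipschitz function. -/
theorem ofReal_sq_sub_le_lintegral_deriv {w : ℝ → ℝ} {M : NNReal} (hw : LipschitzWith M w)
    {a b : ℝ} (hab : a ≤ b) :
    ENNReal.ofReal ((w b - w a) ^ 2) ≤
      ENNReal.ofReal (b - a) * ∫⁻ t in Ioc a b, ENNReal.ofReal (deriv w t ^ 2) := by
  have hbd : ∀ t, |deriv w t| ≤ M := fun t => norm_deriv_le_of_lipschitz hw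
  have hint1 : IntegrableOn (deriv w) (Ioc a b) :=
    Measure.integrableOn_of_bounded (M := M) (by simp)
      (measurable_deriv w).aestronglyMeasurable (Eventually.of_forall hbd)
  have hint2 : IntegrableOn (fun t => deriv w t ^ 2) (Ioc a b) :=
    Measure.integrableOn_of_bounded (M := (M : ℝ) ^ 2) (by simp)
      ((measurable_deriv w).pow_const 2).aestronglyMeasurable
      (Eventually.of_forall fun t => by
        rw [Real.norm_eq_abs, abs_pow]
        exact pow_le_pow_left₀ (abs_nonneg _) (hbd t) 2)
  have hftc : ∫ t in Ioc a b, deriv w t = w b - w a := by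
    rw [← intervalIntegral.integral_of_le hab]
    exact (hw.lipschitzOnWith (s := uIcc a b)).absolutelyContinuousOnInterval.integral_deriv_eq_sub
  rw [← ofReal_integral_eq_lintegral_ofReal hint2 (Eventually.of_forall fun t => sq_nonneg _),
    ← ENNReal.ofReal_mul (sub_nonneg.2 hab)]
  refine ENNReal.ofReal_le_ofReal ?_
  rcases hab.eq_or_lt with rfl | hlt
  · simp
  -- integrate the square of the difference of the derivative and its mean value
  set m := (w b - w a) / (b - a) with hm
  have hba : 0 < b - a := sub_pos.2 hlt
  have h0 : 0 ≤ ∫ t in Ioc a b, (deriv w t - m) ^ 2 := integral_nonneg fun t => sq_nonneg _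
  have h1 : ∫ t in Ioc a b, (deriv w t - m) ^ 2 =
      (∫ t in Ioc a b, deriv w t ^ 2) - 2 * m * (w b - w a) + m ^ 2 * (b - a) := by
    have e : ∀ t, (deriv w t - m) ^ 2 = deriv w t ^ 2 - 2 * m * deriv w t + m ^ 2 := fun t => by
      ring
    simp_rw [e]
    have i1 : IntegrableOn (fun t => 2 * m * deriv w t) (Ioc a b) := hint1.const_mul _
    have i2 : IntegrableOn (fun t => deriv w t ^ 2 - 2 * m * deriv w t) (Ioc a b) := hint2.sub i1
    rw [integral_add i2 (integrable_const _), integral_sub hint2 i1, integral_const_mul, hftc]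
    simp [hab, mul_comm]
  rw [h1] at h0
  have h2 : w b - w a = m * (b - a) := by rw [hm]; field_simp
  rw [h2] at h0 ⊢
  nlinarith

/-! ### Cells of a triangulation -/

theorem volume_convexHull_eq_zero {f : Finset Plane} (hf : f.card ≤ 2) :
    volume (convexHull ℝ (f : Set Plane)) = 0 := by
  classical
  have hcol : Collinear ℝ (f : Set Plane) := by
    rcases Nat.lt_or_ge f.card 2 with h | h
    · have h1 := Finset.card_le_one.1 (Nat.lt_succ_iff.1 h)
      have h2 : (f : Set Plane).Subsingleton := fun x hx y hy => h1 x hx y hy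
      rcases h2.eq_empty_or_singleton with h3 | ⟨x, h3⟩ <;> rw [h3]
      · exact collinear_empty ℝ Plane
      · exact collinear_singleton ℝ x
    · obtain ⟨x, y, -, rfl⟩ := Finset.card_eq_two.1 (le_antisymm hf h)
      simpa using collinear_pair ℝ x y
  refine measure_mono_null (convexHull_subset_affineSpan _)
    (Measure.addHaar_affineSubspace _ _ fun h => ?_)
  have h1 := collinear_iff_finrank_le_one.1 hcol
  rw [← direction_affineSpan, h, AffineSubspace.direction_top, finrank_top] at h1
  simp at h1

namespace Triangulation

variable {Ω : Set Plane} (T : Triangulation Ω)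

theorem finite_cells : T.cells.Finite := by
  refine (T.finite.image fun f : Finset Plane => convexHull ℝ (f : Set Plane)).subset ?_
  rintro K ⟨f, hf, -, rfl⟩
  exact ⟨f, hf, rfl⟩

variable {T}

theorem isCompact_of_mem_cells {K : Set Plane} (hK : K ∈ T.cells) : IsCompact K := by
  obtain ⟨f, -, -, rfl⟩ := hK
  exact f.finite_toSet.isCompact_convexHull (𝕜 := ℝ)

theorem convex_of_mem_cells {K : Set Plane} (hK : K ∈ T.cells) : Convex ℝ K := by
  obtain ⟨f, -, -, rfl⟩ := hK
  exact convex_convexHull ℝ _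

theorem measurableSet_of_mem_cells {K : Set Plane} (hK : K ∈ T.cells) : MeasurableSet K :=
  (isCompact_of_mem_cells hK).isClosed.measurableSet

theorem subset_closure_of_mem_cells {K : Set Plane} (hK : K ∈ T.cells) : K ⊆ closure Ω := by
  obtain ⟨f, hf, -, rfl⟩ := hK
  rw [← T.space_eq]
  exact T.complex.convexHull_subset_space hf

variable (T)

/-- The triangles cover the closure of an open set: the remaining faces are degenerate, so that
they cannot fill an open set. -/
theorem exists_cell_of_mem_closure (hΩ : IsOpen Ω) {x : Plane} (hx : x ∈ closure Ω) :
    ∃ K ∈ T.cells, x ∈ K := by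
  have hcl : IsClosed (⋃ K ∈ T.cells, K) :=
    T.finite_cells.isClosed_biUnion fun K hK => (isCompact_of_mem_cells hK).isClosed
  have hnull : volume (Ω \ ⋃ K ∈ T.cells, K) = 0 := by
    refine measure_mono_null (t := ⋃ f ∈ {f ∈ T.complex.faces | f.card ≤ 2},
      convexHull ℝ (f : Set Plane)) ?_ ?_
    · rintro y ⟨hy, hyU⟩
      have : y ∈ T.complex.space := by rw [T.space_eq]; exact subset_closure hy
      obtain ⟨f, hf, hyf⟩ := Geometry.SimplicialComplex.mem_space_iff.1 this
      refine mem_biUnion (x := f) ⟨hf, ?_⟩ hyf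
      have hcard := (T.complex.indep hf).card_le_finrank_succ
      have h2 := Submodule.finrank_le (vectorSpan ℝ (range ((↑) : f → Plane)))
      simp only [Fintype.card_coe, finrank_euclideanSpace, Fintype.card_fin] at hcard h2
      have h3 : f.card ≠ 3 := fun h => hyU (mem_biUnion ⟨f, hf, h, rfl⟩ hyf)
      omega
    · exact (measure_biUnion_null_iff (T.finite.subset fun f hf => hf.1).countable).2
        fun f hf => volume_convexHull_eq_zero hf.2
  have hsub : Ω ⊆ ⋃ K ∈ T.cells, K := by
    rw [← sdiff_eq_empty]
    exact (hΩ.sdiff hcl).measure_eq_zero_iff volume |>.1 hnull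
  have := closure_minimal hsub hcl hx
  simpa using this

theorem volume_inter_cells {K K' : Set Plane} (hK : K ∈ T.cells) (hK' : K' ∈ T.cells)
    (h : K ≠ K') : volume (K ∩ K') = 0 := by
  classical
  obtain ⟨f, hf, hc, rfl⟩ := hK
  obtain ⟨f', hf', hc', rfl⟩ := hK'
  rw [T.complex.convexHull_inter_convexHull hf hf', ← Finset.coe_inter]
  refine volume_convexHull_eq_zero ?_
  have hne : f ≠ f' := fun e => h (by rw [e])
  by_contra! h3
  have h1 : f ∩ f' = f := Finset.eq_of_subset_of_card_le Finset.inter_subset_left (by omega)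
  have h2 : f ∩ f' = f' := Finset.eq_of_subset_of_card_le Finset.inter_subset_right (by omega)
  exact hne (h1.symm.trans h2)

/-! ### Finite element functions -/

/-- The gradient, as a continuous linear form, of an affine function. -/
noncomputable def affineGradient (g : Plane →ᵃ[ℝ] ℝ) : Plane →L[ℝ] ℝ :=
  LinearMap.toContinuousLinearMap g.linear

theorem affine_sub_eq (g : Plane →ᵃ[ℝ] ℝ) (x y : Plane) : g x - g y = affineGradient g (x - y) := by
  simp [affineGradient, ← vsub_eq_sub, AffineMap.linearMap_vsub]

theorem abs_affine_sub_le (g : Plane →ᵃ[ℝ] ℝ) (x y : Plane) :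
    |g x - g y| ≤ ‖affineGradient g‖ * ‖x - y‖ := by
  rw [affine_sub_eq]
  exact (affineGradient g).le_opNorm _

theorem hasFDerivAt_affine (g : Plane →ᵃ[ℝ] ℝ) (x : Plane) :
    HasFDerivAt g (affineGradient g) x := by
  have h : (g : Plane → ℝ) = fun y => affineGradient g (y - x) + g x := by
    ext y; rw [← affine_sub_eq]; ring
  rw [h]
  simpa using ((affineGradient g).hasFDerivAt.comp x ((hasFDerivAt_id x).sub_const x)).add_const
    (g x)

variable {T}

/-- A `P¹` finite element function is Lipschitz on a convex domain. -/
theorem IsP1.exists_lipschitzOnWith {v : Plane → ℝ} (hv : T.IsP1 v) (hΩ : IsOpen Ω)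
    (hconv : Convex ℝ Ω) : ∃ M, LipschitzOnWith M v (closure Ω) := by
  obtain ⟨hvc, hva⟩ := hv
  choose! g hg using hva
  obtain ⟨M, hM⟩ := (T.finite_cells.image fun K => ‖affineGradient (g K)‖).bddAbove
  have hM' : ∀ K ∈ T.cells, ‖affineGradient (g K)‖ ≤ max M 0 := fun K hK =>
    (hM (mem_image_of_mem _ hK)).trans (le_max_left _ _)
  refine ⟨⟨max M 0, le_max_right _ _⟩, LipschitzOnWith.of_dist_le_mul fun x hx y hy => ?_⟩
  have hmem : ∀ u ∈ Icc (0 : ℝ) 1, AffineMap.lineMap y x u ∈ closure Ω := fun u hu =>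
    hconv.closure.lineMap_mem hy hx hu
  have key := abs_sub_le_of_finite_closed_cover T.finite_cells
    (fun K hK => (isCompact_of_mem_cells hK).isClosed)
    (c := fun u : ℝ => AffineMap.lineMap (k := ℝ) y x u) AffineMap.lineMap_continuous
    zero_le_one (fun u hu => T.exists_cell_of_mem_closure hΩ (hmem u hu))
    (f := fun u => v (AffineMap.lineMap y x u))
    (hvc.comp AffineMap.lineMap_continuous.continuousOn hmem) (M := max M 0 * dist x y) ?_
  · simp only [AffineMap.lineMap_apply_one, AffineMap.lineMap_apply_zero, sub_zero, mul_one] at key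
    exact key
  · intro K hK t u ht hu
    rw [hg K hK ht, hg K hK hu]
    refine (abs_affine_sub_le _ _ _).trans ?_
    rw [← dist_eq_norm, dist_lineMap_lineMap, Real.dist_eq, dist_comm y x]
    calc _ ≤ max M 0 * (|t - u| * dist x y) :=
          mul_le_mul_of_nonneg_right (hM' K hK) (by positivity)
      _ = _ := by ring

/-- Along a curve of speed at most one, a piecewise affine function has at each time a derivative
bounded by its gradient on some triangle that contains the current point. This also holds where the
curve follows an edge, across which the gradient jumps. -/
theorem exists_cell_abs_deriv_le (hΩ : IsOpen Ω) {v : Plane → ℝ} {g : Set Plane → Plane →ᵃ[ℝ] ℝ}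
    (hg : ∀ K ∈ T.cells, EqOn v (g K) K) {c : ℝ → Plane} (hc : LipschitzWith 1 c)
    (hmem : ∀ t, c t ∈ closure Ω) {t : ℝ} (hd : DifferentiableAt ℝ (fun u => v (c u)) t) :
    ∃ K ∈ T.cells, c t ∈ K ∧ |deriv (fun u => v (c u)) t| ≤ ‖affineGradient (g K)‖ := by
  obtain ⟨K, hK, htK, hfr⟩ := exists_frequently_mem_right T.finite_cells
    (fun K hK => (isCompact_of_mem_cells hK).isClosed) hc.continuous (lt_add_one t)
    fun u _ => T.exists_cell_of_mem_closure hΩ (hmem u)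
  refine ⟨K, hK, htK, ?_⟩
  have htend : Tendsto (fun u => |slope (fun u => v (c u)) t u|) (𝓝[>] t)
      (𝓝 |deriv (fun u => v (c u)) t|) :=
    ((hasDerivAt_iff_tendsto_slope.1 hd.hasDerivAt).mono_left
      (nhdsWithin_mono _ fun u hu => ne_of_gt hu)).abs
  refine isClosed_Iic.mem_of_frequently_of_tendsto (s := Iic ‖affineGradient (g K)‖)
    ((hfr.and_eventually self_mem_nhdsWithin).mono fun u hu => ?_) htend
  have hu' : 0 < u - t := sub_pos.2 hu.2
  rw [mem_Iic, slope_def_field, abs_div, abs_of_pos hu', div_le_iff₀ hu', hg K hK hu.1,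
    hg K hK htK]
  refine (abs_affine_sub_le _ _ _).trans (mul_le_mul_of_nonneg_left ?_ (norm_nonneg _))
  have := hc.dist_le_mul u t
  rwa [NNReal.coe_one, one_mul, Real.dist_eq, abs_of_pos hu', dist_eq_norm] at this

/-- The sum of the squared gradients on the triangles that contain the point; it dominates the
squared gradient also on edges, where the gradient has several one-sided limits. -/
noncomputable def gradientSq (T : Triangulation Ω) (g : Set Plane → Plane →ᵃ[ℝ] ℝ) (x : Plane) :
    ℝ≥0∞ :=
  ∑ K ∈ T.finite_cells.toFinset,
    K.indicator (fun _ => ENNReal.ofReal (‖affineGradient (g K)‖ ^ 2)) x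

theorem measurable_gradientSq (g : Set Plane → Plane →ᵃ[ℝ] ℝ) : Measurable (T.gradientSq g) :=
  Finset.measurable_fun_sum _ fun _ hK =>
    measurable_const.indicator (measurableSet_of_mem_cells (T.finite_cells.mem_toFinset.1 hK))

theorem ofReal_le_gradientSq (g : Set Plane → Plane →ᵃ[ℝ] ℝ) {K : Set Plane} (hK : K ∈ T.cells)
    {x : Plane} (hx : x ∈ K) : ENNReal.ofReal (‖affineGradient (g K)‖ ^ 2) ≤ T.gradientSq g x := by
  refine le_trans (le_of_eq ?_) (Finset.single_le_sum
    (f := fun K => K.indicator (fun _ => ENNReal.ofReal (‖affineGradient (g K)‖ ^ 2)) x)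
    (fun _ _ => zero_le) (T.finite_cells.mem_toFinset.2 hK))
  simp [hx]

theorem ofReal_sq_sub_le_lintegral_gradientSq (hΩ : IsOpen Ω) (hconv : Convex ℝ Ω) {v : Plane → ℝ}
    (hv : T.IsP1 v) {g : Set Plane → Plane →ᵃ[ℝ] ℝ} (hg : ∀ K ∈ T.cells, EqOn v (g K) K)
    {c : ℝ → Plane} (hc : LipschitzWith 1 c) (hmem : ∀ t, c t ∈ closure Ω) {a b : ℝ}
    (hab : a ≤ b) :
    ENNReal.ofReal ((v (c b) - v (c a)) ^ 2) ≤
      ENNReal.ofReal (b - a) * ∫⁻ t in Ioc a b, T.gradientSq g (c t) := by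
  obtain ⟨M, hM⟩ := hv.exists_lipschitzOnWith hΩ hconv
  have hw : LipschitzWith (M * 1) fun t => v (c t) :=
    lipschitzOnWith_univ.1 (hM.comp hc.lipschitzOnWith fun t _ => hmem t)
  refine (ofReal_sq_sub_le_lintegral_deriv hw hab).trans ?_
  gcongr with t
  by_cases hd : DifferentiableAt ℝ (fun u => v (c u)) t
  · obtain ⟨K, hK, htK, hle⟩ := exists_cell_abs_deriv_le hΩ hg hc hmem hd
    refine le_trans (ENNReal.ofReal_le_ofReal ?_) (ofReal_le_gradientSq g hK htK)
    rw [← sq_abs]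
    exact pow_le_pow_left₀ (abs_nonneg _) hle 2
  · simp [deriv_zero_of_not_differentiableAt hd]

theorem fderiv_eq_of_mem_interior {v : Plane → ℝ} {g : Plane →ᵃ[ℝ] ℝ} {K : Set Plane}
    (hg : EqOn v g K) {x : Plane} (hx : x ∈ interior K) : fderiv ℝ v x = affineGradient g :=
  ((hasFDerivAt_affine g x).congr_of_eventuallyEq
    (hg.eventuallyEq_of_mem (mem_interior_iff_mem_nhds.1 hx))).fderiv

theorem sum_gradient_sq_mul_volume_le (hΩ : IsOpen Ω) (hconv : Convex ℝ Ω)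
    (hvol : volume Ω ≠ ∞) {v : Plane → ℝ} {g : Set Plane → Plane →ᵃ[ℝ] ℝ}
    (hg : ∀ K ∈ T.cells, EqOn v (g K) K) :
    ∑ K ∈ T.finite_cells.toFinset, ENNReal.ofReal (‖affineGradient (g K)‖ ^ 2) * volume K ≤
      ENNReal.ofReal (h1Seminorm Ω v ^ 2) := by
  obtain ⟨M, hM⟩ := (T.finite_cells.image fun K => ‖affineGradient (g K)‖).bddAbove
  have hM' : ∀ K ∈ T.cells, ‖affineGradient (g K)‖ ≤ M := fun K hK => hM (mem_image_of_mem _ hK)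
  have hfr : ∀ᵐ x, ∀ K ∈ T.cells, x ∉ frontier K := by
    rw [ae_ball_iff T.finite_cells.countable]
    exact fun K hK => measure_eq_zero_iff_ae_notMem.1 ((convex_of_mem_cells hK).addHaar_frontier _)
  have hint' : ∀ᵐ x, ∀ K ∈ T.cells, x ∈ K → x ∈ interior K := by
    filter_upwards [hfr] with x hx K hK hxK
    by_contra h
    exact hx K hK ⟨subset_closure hxK, h⟩
  have hmeas : Measurable fun x => ‖fderiv ℝ v x‖ ^ 2 := (measurable_fderiv ℝ v).norm.pow_const 2
  have hint : IntegrableOn (fun x => ‖fderiv ℝ v x‖ ^ 2) Ω := by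
    refine Measure.integrableOn_of_bounded (M := M ^ 2) hvol hmeas.aestronglyMeasurable ?_
    filter_upwards [ae_restrict_mem hΩ.measurableSet, ae_restrict_of_ae hint'] with x hx hx'
    obtain ⟨K, hK, hxK⟩ := T.exists_cell_of_mem_closure hΩ (subset_closure hx)
    rw [fderiv_eq_of_mem_interior (hg K hK) (hx' K hK hxK), norm_pow, norm_norm]
    exact pow_le_pow_left₀ (norm_nonneg _) (hM' K hK) 2
  rw [h1Seminorm, Real.sq_sqrt (integral_nonneg fun x => sq_nonneg _),
    ofReal_integral_eq_lintegral_ofReal hint (Eventually.of_forall fun x => sq_nonneg _)]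
  have hmK : ∀ K ∈ T.finite_cells.toFinset, K ∈ T.cells := fun K hK =>
    T.finite_cells.mem_toFinset.1 hK
  calc _ = ∑ K ∈ T.finite_cells.toFinset,
        ∫⁻ x in K ∩ Ω, ENNReal.ofReal (‖fderiv ℝ v x‖ ^ 2) := by
        refine Finset.sum_congr rfl fun K hK => ?_
        have hKc := hmK K hK
        have h1 : volume (K ∩ Ω) = volume K := by
          refine le_antisymm (measure_mono inter_subset_left) ?_
          have hsub : K ⊆ (K ∩ Ω) ∪ frontier Ω := fun x hx => by
            by_cases h : x ∈ Ω
            · exact Or.inl ⟨hx, h⟩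
            · refine Or.inr ⟨subset_closure_of_mem_cells hKc hx, fun h' => h (interior_subset h')⟩
          refine (measure_mono hsub).trans ((measure_union_le _ _).trans_eq ?_)
          rw [hconv.addHaar_frontier volume, add_zero]
        rw [← h1, ← setLIntegral_const]
        refine setLIntegral_congr_fun_ae
          ((measurableSet_of_mem_cells hKc).inter hΩ.measurableSet) ?_
        filter_upwards [hint'] with x hx hxK
        rw [fderiv_eq_of_mem_interior (hg K hKc) (hx K hKc hxK.1)]
    _ = ∫⁻ x in ⋃ K ∈ T.finite_cells.toFinset, K ∩ Ω, ENNReal.ofReal (‖fderiv ℝ v x‖ ^ 2) := by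
        refine (lintegral_biUnion_finset₀ (fun K hK K' hK' hne => ?_) (fun K hK => ?_) _).symm
        · exact measure_mono_null (inter_subset_inter inter_subset_left inter_subset_left)
            (T.volume_inter_cells (hmK K hK) (hmK K' hK') hne)
        · exact ((measurableSet_of_mem_cells (hmK K hK)).inter
            hΩ.measurableSet).nullMeasurableSet
    _ ≤ _ := lintegral_mono_set (iUnion₂_subset fun _ _ => inter_subset_right)

end Triangulation

theorem isBounded_unitSquare : Bornology.IsBounded unitSquare := by
  refine (Metric.isBounded_iff_subset_closedBall 0).2 ⟨2, fun x hx => ?_⟩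
  rw [mem_closedBall_zero_iff, EuclideanSpace.norm_eq, Fin.sum_univ_two]
  refine Real.sqrt_le_iff.2 ⟨by norm_num, ?_⟩
  have h0 := hx 0
  have h1 := hx 1
  simp only [Real.norm_eq_abs, sq_abs]
  nlinarith [h0.1, h0.2, h1.1, h1.2]

/-- Inverse trace inequality: a finite element function has on the boundary curve a squared
gradient of integral at most `C / h` times its squared `H¹` seminorm, since the curve meets each
triangle in a length of at most the order of the ratio of its area and its diameter. -/
theorem exists_lintegral_gradientSq_le {ω : Set Plane} (Γ : SmoothBoundary ω) {σ : ℝ}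
    (hσ : 0 < σ) :
    ∃ C > 0, ∀ (h : ℝ) (T : Triangulation unitSquare), 0 < h → T.IsRegular σ h →
      ∀ (v : Plane → ℝ) (g : Set Plane → Plane →ᵃ[ℝ] ℝ), (∀ K ∈ T.cells, EqOn v (g K) K) →
        ∫⁻ x, T.gradientSq g x ∂Γ.arcLength ≤
          ENNReal.ofReal (C / h * h1Seminorm unitSquare v ^ 2) := by
  obtain ⟨C, hC, H⟩ := Γ.exists_arcLength_le_diam
  refine ⟨C * σ ^ 3 / Real.pi, by positivity, fun h T hh hT v g hg => ?_⟩
  have hK : ∀ K ∈ T.cells,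
      Γ.arcLength K ≤ ENNReal.ofReal (C * σ ^ 3 / Real.pi / h) * volume K := by
    intro K hK
    obtain ⟨⟨z, hz⟩, hd⟩ := hT K hK
    have hd0 : 0 ≤ Metric.diam K := Metric.diam_nonneg
    have h1 := measure_mono (μ := volume) hz
    rw [EuclideanSpace.volume_closedBall_fin_two] at h1
    refine (H K (Triangulation.measurableSet_of_mem_cells hK)
      (Triangulation.isCompact_of_mem_cells hK).isBounded).trans ?_
    refine le_trans ?_ (mul_le_mul_right h1 _)
    rw [← ENNReal.ofReal_pow (by positivity), ← ENNReal.ofReal_mul (by positivity),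
      ← ENNReal.ofReal_mul (by positivity)]
    refine ENNReal.ofReal_le_ofReal ?_
    have e : C * σ ^ 3 / Real.pi / h * ((Metric.diam K / σ) ^ 2 * Real.pi) =
        C * Metric.diam K * (σ * Metric.diam K / h) := by
      field_simp
    rw [e]
    exact le_mul_of_one_le_right (by positivity) ((one_le_div hh).2 hd)
  have hmK : ∀ K ∈ T.finite_cells.toFinset, K ∈ T.cells := fun K hK =>
    T.finite_cells.mem_toFinset.1 hK
  have hmeas : ∀ K ∈ T.finite_cells.toFinset, Measurable
      (K.indicator fun _ : Plane => ENNReal.ofReal (‖Triangulation.affineGradient (g K)‖ ^ 2)) :=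
    fun K hK => measurable_const.indicator
      (Triangulation.measurableSet_of_mem_cells (hmK K hK))
  unfold Triangulation.gradientSq
  rw [lintegral_finsetSum _ hmeas]
  calc _ ≤ ∑ K ∈ T.finite_cells.toFinset, ENNReal.ofReal (C * σ ^ 3 / Real.pi / h) *
        (ENNReal.ofReal (‖Triangulation.affineGradient (g K)‖ ^ 2) * volume K) := by
        refine Finset.sum_le_sum fun K hK' => ?_
        rw [lintegral_indicator_const
          (Triangulation.measurableSet_of_mem_cells (hmK K hK')), mul_left_comm]
        exact mul_le_mul_right (hK K (hmK K hK')) _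
    _ = ENNReal.ofReal (C * σ ^ 3 / Real.pi / h) * ∑ K ∈ T.finite_cells.toFinset,
        (ENNReal.ofReal (‖Triangulation.affineGradient (g K)‖ ^ 2) * volume K) := by
        rw [Finset.mul_sum]
    _ ≤ ENNReal.ofReal (C * σ ^ 3 / Real.pi / h) *
        ENNReal.ofReal (h1Seminorm unitSquare v ^ 2) := by
        gcongr
        exact Triangulation.sum_gradient_sq_mul_volume_le isOpen_unitSquare convex_unitSquare
          isBounded_unitSquare.measure_lt_top.ne hg
    _ = _ := by rw [← ENNReal.ofReal_mul (by positivity)]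

/-! ### Membership in the fractional Sobolev space -/

section Membership

variable {μ : Measure Plane} {r : ℝ}

theorem gagliardo_congr_ae [SFinite μ] {w w' : Plane → ℝ} (h : w =ᵐ[μ] w') (r : ℝ) :
    gagliardo r w =ᵐ[μ.prod μ] gagliardo r w' := by
  filter_upwards [Measure.quasiMeasurePreserving_fst.ae h,
    Measure.quasiMeasurePreserving_snd.ae h] with q h1 h2
  simp only [gagliardo, h1, h2]

theorem mem_fracSobolev_of_ae_eq [SFinite μ] {w w' : Plane → ℝ} (h : w =ᵐ[μ] w')
    (hw' : w' ∈ fracSobolev μ r) : w ∈ fracSobolev μ r :=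
  ⟨hw'.1.ae_eq h.symm, hw'.2.ae_eq (gagliardo_congr_ae h r).symm⟩

theorem measurable_gagliardo {w : Plane → ℝ} (hw : Measurable w) (r : ℝ) :
    Measurable (gagliardo r w) := by
  unfold gagliardo
  by_cases hr : r = 0
  · simp only [hr, if_true]; exact measurable_const
  · simp only [hr, if_false]; fun_prop

/-- The squared integrand of the Gagliardo seminorm in terms of the kernel. -/
theorem enorm_gagliardo_sq_le (r : ℝ) (w : Plane → ℝ) (q : Plane × Plane) :
    ‖gagliardo r w q‖ₑ ^ 2 ≤
      ENNReal.ofReal ((w q.1 - w q.2) ^ 2) * kernel (1 + 2 * r) q.1 q.2 := by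
  by_cases hr : r = 0
  · simp [gagliardo, hr]
  · refine le_of_eq ?_
    simp only [gagliardo, hr, if_false]
    rw [kernel, ← ENNReal.ofReal_mul (sq_nonneg _), ← ofReal_norm,
      ← ENNReal.ofReal_pow (norm_nonneg _), Real.norm_eq_abs, sq_abs, div_pow,
      ← Real.rpow_natCast (‖q.1 - q.2‖ ^ (1 / 2 + r)) 2, ← Real.rpow_mul (norm_nonneg _),
      Real.rpow_neg (norm_nonneg _), div_eq_mul_inv]
    congr 4
    push_cast
    ring

theorem eLpNorm_two_le_of_lintegral_le {α : Type*} [MeasurableSpace α] {ν : Measure α}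
    {f : α → ℝ} {B : ℝ} (hB : 0 ≤ B) (h : ∫⁻ x, ‖f x‖ₑ ^ 2 ∂ν ≤ ENNReal.ofReal B) :
    eLpNorm f 2 ν ≤ ENNReal.ofReal (√B) := by
  rw [eLpNorm_eq_lintegral_rpow_enorm_toReal two_ne_zero ENNReal.ofNat_ne_top,
    Real.sqrt_eq_rpow, ← ENNReal.ofReal_rpow_of_nonneg hB (by norm_num)]
  simp only [ENNReal.toReal_ofNat, ENNReal.rpow_two]
  exact ENNReal.rpow_le_rpow h (by norm_num)

/-- Lipschitz functions are in `H^r` of a bounded curve for `r < 1 / 2`. -/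
theorem mem_fracSobolev_of_lipschitzWith [IsFiniteMeasure μ] {A : Set Plane} (hA : IsCompact A)
    (hμ : ∀ᵐ x ∂μ, x ∈ A) (hr : 0 ≤ r) (hr' : r < 1 / 2) {w : Plane → ℝ} {M : NNReal}
    (hw : LipschitzWith M w) : w ∈ fracSobolev μ r := by
  obtain ⟨B, hB⟩ := hA.exists_bound_of_continuousOn hw.continuous.continuousOn
  refine ⟨MemLp.of_bound hw.continuous.aestronglyMeasurable B
    (hμ.mono fun x hx => hB x hx), ?_⟩
  refine MemLp.of_bound (measurable_gagliardo hw.continuous.measurable r).aestronglyMeasurable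
    (M * Metric.diam A ^ (1 / 2 - r)) ?_
  filter_upwards [Measure.quasiMeasurePreserving_fst.ae hμ,
    Measure.quasiMeasurePreserving_snd.ae hμ] with q h1 h2
  have hD : 0 ≤ Metric.diam A := Metric.diam_nonneg
  by_cases hr0 : r = 0
  · simp only [gagliardo, hr0, if_true, norm_zero]; positivity
  simp only [gagliardo, hr0, if_false]
  rw [norm_div, Real.norm_of_nonneg (Real.rpow_nonneg (norm_nonneg _) _)]
  have hl : ‖w q.1 - w q.2‖ ≤ M * ‖q.1 - q.2‖ := by
    simpa [dist_eq_norm] using hw.dist_le_mul q.1 q.2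
  have hd : ‖q.1 - q.2‖ ≤ Metric.diam A := by
    rw [← dist_eq_norm]; exact Metric.dist_le_diam_of_mem hA.isBounded h1 h2
  rcases (norm_nonneg (q.1 - q.2)).eq_or_lt with h0 | h0
  · rw [← h0, Real.zero_rpow (by linarith), div_zero]; positivity
  · rw [div_le_iff₀ (by positivity)]
    calc _ ≤ M * ‖q.1 - q.2‖ := hl
      _ = M * ‖q.1 - q.2‖ ^ (1 / 2 - r) * ‖q.1 - q.2‖ ^ (1 / 2 + r) := by
          rw [mul_assoc, ← Real.rpow_add h0]
          norm_num
      _ ≤ _ := by gcongr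

end Membership

/-! ### Interaction of an arc with its complement -/

section Kernel

variable {μ : Measure Plane} [IsFiniteMeasure μ] {A : Set Plane} {p : ℝ}

theorem lintegral_indicator_prod_compl (hA : MeasurableSet A) (c : ℝ≥0∞) :
    ∫⁻ q, (A ×ˢ Aᶜ).indicator (fun q => c * kernel p q.1 q.2) q ∂μ.prod μ =
      c * ∫⁻ x in A, ∫⁻ y in Aᶜ, kernel p x y ∂μ ∂μ := by
  rw [lintegral_indicator (hA.prod hA.compl), lintegral_const_mul _ (measurable_kernel p),
    setLIntegral_prod _ (measurable_kernel p).aemeasurable]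

theorem lintegral_indicator_compl_prod (hA : MeasurableSet A) (c : ℝ≥0∞) :
    ∫⁻ q, (Aᶜ ×ˢ A).indicator (fun q => c * kernel p q.1 q.2) q ∂μ.prod μ =
      c * ∫⁻ x in A, ∫⁻ y in Aᶜ, kernel p x y ∂μ ∂μ := by
  rw [← lintegral_indicator_prod_compl hA, ← lintegral_prod_swap]
  refine lintegral_congr fun q => ?_
  by_cases h : q ∈ A ×ˢ Aᶜ
  · rw [indicator_of_mem h, indicator_of_mem (show q.swap ∈ Aᶜ ×ˢ A from ⟨h.2, h.1⟩)]
    simp only [Prod.fst_swap, Prod.snd_swap, kernel_comm p q.2 q.1]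
  · rw [indicator_of_notMem h, indicator_of_notMem fun h' => h ⟨h'.2, h'.1⟩]

theorem indicator_mem_fracSobolev {r : ℝ} (hA : MeasurableSet A)
    (h : r ≠ 0 → ∫⁻ x in A, ∫⁻ y in Aᶜ, kernel (1 + 2 * r) x y ∂μ ∂μ ≠ ∞) :
    A.indicator (fun _ => (1 : ℝ)) ∈ fracSobolev μ r := by
  have hm : Measurable (A.indicator fun _ => (1 : ℝ)) := measurable_const.indicator hA
  refine ⟨memLp_indicator_const 2 hA 1 (Or.inr (measure_ne_top _ _)), ?_⟩
  refine ⟨(measurable_gagliardo hm r).aestronglyMeasurable, ?_⟩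
  by_cases hr : r = 0
  · have : gagliardo r (A.indicator fun _ => (1 : ℝ)) = 0 := by ext q; simp [gagliardo, hr]
    rw [this]; simp
  rw [eLpNorm_lt_top_iff_lintegral_rpow_enorm_lt_top two_ne_zero ENNReal.ofNat_ne_top]
  simp only [ENNReal.toReal_ofNat, ENNReal.rpow_two]
  have hpt : ∀ q : Plane × Plane, ‖gagliardo r (A.indicator fun _ => (1 : ℝ)) q‖ₑ ^ 2 ≤
      (A ×ˢ Aᶜ).indicator (fun q => 1 * kernel (1 + 2 * r) q.1 q.2) q +
        (Aᶜ ×ˢ A).indicator (fun q => 1 * kernel (1 + 2 * r) q.1 q.2) q := by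
    intro q
    refine (enorm_gagliardo_sq_le r _ q).trans ?_
    by_cases h1 : q.1 ∈ A <;> by_cases h2 : q.2 ∈ A <;> simp [h1, h2, indicator]
  refine (lintegral_mono hpt).trans_lt ?_
  rw [lintegral_add_left (((measurable_kernel (1 + 2 * r)).const_mul 1).indicator (hA.prod hA.compl)),
    lintegral_indicator_prod_compl hA, lintegral_indicator_compl_prod hA]
  simpa [lt_top_iff_ne_top] using h hr

end Kernel

/-! ### The error of piecewise constant interpolation on the arcs -/

section Interpolation

variable {ω : Set Plane} {Γ : SmoothBoundary ω}

/-- `G` plays the role of the squared tangential derivative of `v` on the curve: the squared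
increment of `v` over an arc is at most the length of the arc times the integral of `G` on it. -/
def DominatesIncrements (Γ : SmoothBoundary ω) (v : Plane → ℝ) (G : Plane → ℝ≥0∞) : Prop :=
  ∀ k a b, a ≤ b → ENNReal.ofReal ((v (Γ.X k b) - v (Γ.X k a)) ^ 2) ≤
    ENNReal.ofReal (b - a) * ∫⁻ t in Ioc a b, G (Γ.X k t)

/-- The piecewise constant function with value `y i` on the `i`-th arc. -/
noncomputable def Subdivision.piecewiseConst (S : Subdivision Γ) (y : Fin S.N → ℝ) : Plane → ℝ :=
  ∑ i, y i • S.arcIndicator i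

variable (S : Subdivision Γ)

theorem Subdivision.piecewiseConst_apply (y : Fin S.N → ℝ) {x : Plane} {i : Fin S.N}
    (hi : x ∈ S.arc i) (huniq : ∀ j, x ∈ S.arc j → j = i) : S.piecewiseConst y x = y i := by
  rw [piecewiseConst, Finset.sum_apply, Finset.sum_eq_single i]
  · simp [arcIndicator, hi]
  · intro j _ hj
    simp [arcIndicator, show x ∉ S.arc j from fun h => hj (huniq j h)]
  · exact fun h => absurd (Finset.mem_univ _) h

theorem Subdivision.arcLength_arc (i : Fin S.N) :
    Γ.arcLength (S.arc i) = ENNReal.ofReal (S.length i) := by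
  have := S.setLIntegral_arc i (f := fun _ => 1) measurable_const
  simpa [Subdivision.length] using this

theorem Subdivision.sum_setLIntegral_arc_le {G : Plane → ℝ≥0∞} (hG : Measurable G) :
    ∑ i, ∫⁻ x in S.arc i, G x ∂Γ.arcLength ≤ ∫⁻ x, G x ∂Γ.arcLength := by
  simp_rw [← lintegral_indicator (S.measurableSet_arc _)]
  rw [← lintegral_finsetSum _ fun i _ => hG.indicator (S.measurableSet_arc i)]
  refine lintegral_mono_ae ?_
  filter_upwards [S.ae_existsUnique_arc] with x hx
  obtain ⟨i, -, huniq⟩ := hx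
  rw [Finset.sum_eq_single i]
  · exact indicator_le_self _ _ _
  · exact fun j _ hj => indicator_of_notMem (fun h => hj (huniq j h)) _
  · exact fun h => absurd (Finset.mem_univ _) h

variable {S} {v : Plane → ℝ} {G : Plane → ℝ≥0∞}

theorem DominatesIncrements.ofReal_sq_sub_le (hv : DominatesIncrements Γ v G) (hG : Measurable G)
    (i : Fin S.N) {t u : ℝ} (ht : t ∈ Icc (S.a i) (S.b i)) (hu : u ∈ Icc (S.a i) (S.b i)) :
    ENNReal.ofReal ((v (Γ.X (S.comp i) t) - v (Γ.X (S.comp i) u)) ^ 2) ≤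
      ENNReal.ofReal |t - u| * ∫⁻ x in S.arc i, G x ∂Γ.arcLength := by
  wlog h : u ≤ t generalizing t u
  · have := this hu ht (le_of_not_ge h)
    rwa [abs_sub_comm, ← neg_sub, neg_sq] at this
  rw [S.setLIntegral_arc i hG, abs_of_nonneg (sub_nonneg.2 h)]
  refine (hv _ u t h).trans ?_
  gcongr
  exacts [hu.1, ht.2]

theorem DominatesIncrements.ofReal_sq_sub_le_length (hv : DominatesIncrements Γ v G)
    (hG : Measurable G) (i : Fin S.N) {x y : Plane} (hx : x ∈ S.arc i) (hy : y ∈ S.arc i) :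
    ENNReal.ofReal ((v x - v y) ^ 2) ≤
      ENNReal.ofReal (S.length i) * ∫⁻ x in S.arc i, G x ∂Γ.arcLength := by
  obtain ⟨t, ht, rfl⟩ := hx
  obtain ⟨u, hu, rfl⟩ := hy
  refine (hv.ofReal_sq_sub_le hG i ht hu).trans ?_
  gcongr
  rw [Subdivision.length, abs_le]
  constructor <;> linarith [ht.1, ht.2, hu.1, hu.2]

theorem lintegral_interpolation_error_sq_le (hv : DominatesIncrements Γ v G) (hG : Measurable G)
    {x : Fin S.N → Plane} (hx : ∀ i, x i ∈ S.arc i) {l : ℝ} (hl : ∀ i, S.length i ≤ l)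
    {p : ℝ} (hp : 1 ≤ p) (hp2 : p < 2) :
    ∫⁻ z, ‖(v - S.piecewiseConst fun i => v (x i)) z‖ₑ ^ 2 ∂Γ.arcLength ≤
      ENNReal.ofReal (Γ.totalLength ^ (p - 1) * l ^ (3 - p)) * ∫⁻ z, G z ∂Γ.arcLength := by
  set D : Fin S.N → ℝ≥0∞ := fun i => ∫⁻ z in S.arc i, G z ∂Γ.arcLength with hD
  have hpt : ∀ᵐ z ∂Γ.arcLength, ‖(v - S.piecewiseConst fun i => v (x i)) z‖ₑ ^ 2 ≤
      ∑ i, (S.arc i).indicator (fun _ => ENNReal.ofReal (S.length i) * D i) z := by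
    filter_upwards [S.ae_existsUnique_arc] with z hz
    obtain ⟨i, hi, huniq⟩ := hz
    rw [Pi.sub_apply, S.piecewiseConst_apply _ hi huniq, ← ofReal_norm,
      ← ENNReal.ofReal_pow (norm_nonneg _), Real.norm_eq_abs, sq_abs]
    refine (hv.ofReal_sq_sub_le_length hG i hi (hx i)).trans (le_trans (le_of_eq ?_)
      (Finset.single_le_sum (f := fun i => (S.arc i).indicator
        (fun _ => ENNReal.ofReal (S.length i) * D i) z) (fun _ _ => zero_le) (Finset.mem_univ i)))
    simp only [indicator_of_mem hi, hD]
  refine (lintegral_mono_ae hpt).trans ?_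
  rw [lintegral_finsetSum _ fun i _ => measurable_const.indicator (S.measurableSet_arc i)]
  calc _ ≤ ∑ i, ENNReal.ofReal (Γ.totalLength ^ (p - 1) * l ^ (3 - p)) * D i := by
        refine Finset.sum_le_sum fun i _ => ?_
        have hli := S.length_pos i
        rw [lintegral_indicator_const (S.measurableSet_arc i), S.arcLength_arc,
          mul_right_comm, ← ENNReal.ofReal_mul hli.le]
        refine mul_le_mul_left (ENNReal.ofReal_le_ofReal ?_) _
        have h1 : S.length i ≤ Γ.totalLength := (S.length_le i).trans (Γ.L_le_totalLength _)
        calc S.length i * S.length i = S.length i ^ (p - 1) * S.length i ^ (3 - p) := by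
              rw [← Real.rpow_add hli, show p - 1 + (3 - p) = 2 by ring, Real.rpow_two, sq]
          _ ≤ _ := by
              have h2 := hl i
              have h3 := Γ.totalLength_nonneg
              gcongr
              linarith
    _ ≤ _ := by
        rw [← Finset.mul_sum]
        gcongr
        exact S.sum_setLIntegral_arc_le hG

/-- On a single arc the interpolation error has the differences of `v`, and these are controlled by
the parameter distance. -/
theorem lintegral_arc_prod_arc_le {p C : ℝ}
    (hC : ∀ (k : Fin Γ.m) (a b : ℝ), a < b → b ≤ a + Γ.L k →
      ∫⁻ t in Ioc a b, ∫⁻ u in Ioc a b,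
        ENNReal.ofReal |t - u| * kernel p (Γ.X k t) (Γ.X k u) ≤
        ENNReal.ofReal (C * (b - a) ^ (3 - p)))
    (hv : DominatesIncrements Γ v G) (hG : Measurable G) (hvm : Measurable v) (i : Fin S.N) :
    ∫⁻ q, (S.arc i ×ˢ S.arc i).indicator
        (fun q => ENNReal.ofReal ((v q.1 - v q.2) ^ 2) * kernel p q.1 q.2) q
        ∂Γ.arcLength.prod Γ.arcLength ≤
      ENNReal.ofReal (C * S.length i ^ (3 - p)) * ∫⁻ z in S.arc i, G z ∂Γ.arcLength := by
  have hA := S.measurableSet_arc i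
  have hK := measurable_kernel p
  have hF : Measurable fun q : Plane × Plane =>
      ENNReal.ofReal ((v q.1 - v q.2) ^ 2) * kernel p q.1 q.2 := by fun_prop
  rw [lintegral_indicator (hA.prod hA), setLIntegral_prod _ hF.aemeasurable,
    S.setLIntegral_arc i hF.lintegral_prod_right']
  set D := ∫⁻ z in S.arc i, G z ∂Γ.arcLength
  have hinner : ∀ t ∈ Ioc (S.a i) (S.b i),
      ∫⁻ y in S.arc i, ENNReal.ofReal ((v (Γ.X (S.comp i) t) - v y) ^ 2) *
        kernel p (Γ.X (S.comp i) t) y ∂Γ.arcLength ≤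
      (∫⁻ u in Ioc (S.a i) (S.b i), ENNReal.ofReal |t - u| *
        kernel p (Γ.X (S.comp i) t) (Γ.X (S.comp i) u)) * D := by
    intro t ht
    have hm : Measurable fun u : ℝ => ENNReal.ofReal |t - u| *
        kernel p (Γ.X (S.comp i) t) (Γ.X (S.comp i) u) := by
      have h1 : Measurable fun y => kernel p (Γ.X (S.comp i) t) y := hK.of_uncurry_left
      have h2 := h1.comp (Γ.measurable_X (S.comp i))
      exact Measurable.mul (by fun_prop) h2
    rw [S.setLIntegral_arc i (f := fun y => ENNReal.ofReal ((v (Γ.X (S.comp i) t) - v y) ^ 2) *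
      kernel p (Γ.X (S.comp i) t) y) (hF.comp measurable_prodMk_left), ← lintegral_mul_const _ hm]
    refine setLIntegral_mono' measurableSet_Ioc fun u hu => ?_
    calc _ ≤ ENNReal.ofReal |t - u| * D * kernel p (Γ.X (S.comp i) t) (Γ.X (S.comp i) u) :=
          mul_le_mul_left (hv.ofReal_sq_sub_le hG i ⟨ht.1.le, ht.2⟩ ⟨hu.1.le, hu.2⟩) _
      _ = _ := by ring
  refine (setLIntegral_mono' measurableSet_Ioc hinner).trans ?_
  have hm2 : Measurable fun t => ∫⁻ u in Ioc (S.a i) (S.b i), ENNReal.ofReal |t - u| *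
      kernel p (Γ.X (S.comp i) t) (Γ.X (S.comp i) u) := by
    refine Measurable.lintegral_prod_right' (f := fun q : ℝ × ℝ => ENNReal.ofReal |q.1 - q.2| *
      kernel p (Γ.X (S.comp i) q.1) (Γ.X (S.comp i) q.2)) ?_
    have h2 := hK.comp (((Γ.measurable_X (S.comp i)).comp measurable_fst).prodMk
      ((Γ.measurable_X (S.comp i)).comp measurable_snd))
    exact Measurable.mul (by fun_prop) h2
  rw [lintegral_mul_const _ hm2]
  exact mul_le_mul_left (hC _ _ _ (S.lt i) (S.le_period i)) _

/-- The Gagliardo seminorm of the interpolation error. For points on different arcs the values of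
the error are estimated separately, and the kernel is integrated over the complement of an arc. -/
theorem exists_lintegral_gagliardo_interpolation_error_le (Γ : SmoothBoundary ω) {r : ℝ}
    (hr : 0 < r) (hr' : r < 1 / 2) :
    ∃ C > 0, ∀ (S : Subdivision Γ) (v : Plane → ℝ) (G : Plane → ℝ≥0∞),
      DominatesIncrements Γ v G → Measurable G → Measurable v →
      ∀ x : Fin S.N → Plane, (∀ i, x i ∈ S.arc i) → ∀ l : ℝ, (∀ i, S.length i ≤ l) →
        ∫⁻ q, ‖gagliardo r (v - S.piecewiseConst fun i => v (x i)) q‖ₑ ^ 2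
          ∂Γ.arcLength.prod Γ.arcLength ≤
        ENNReal.ofReal (C * l ^ (2 - 2 * r)) * ∫⁻ z, G z ∂Γ.arcLength := by
  set p := 1 + 2 * r with hp
  have hp1 : 1 < p := by linarith
  have hp2 : p < 2 := by linarith
  obtain ⟨C₁, hC₁, H₁⟩ := exists_lintegral_abs_mul_kernel_le Γ hp1 hp2
  obtain ⟨C₂, hC₂, H₂⟩ := exists_lintegral_kernel_arc_compl_le Γ hp1 hp2
  refine ⟨C₁ + 4 * C₂, by positivity, fun S v G hv hG hvm x hx l hl => ?_⟩
  set D : Fin S.N → ℝ≥0∞ := fun i => ∫⁻ z in S.arc i, G z ∂Γ.arcLength with hD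
  set e := v - S.piecewiseConst fun i => v (x i) with he
  set Q : Fin S.N → Plane × Plane → ℝ≥0∞ := fun i => (S.arc i ×ˢ S.arc i).indicator
    (fun q => ENNReal.ofReal ((v q.1 - v q.2) ^ 2) * kernel p q.1 q.2) with hQ
  set c : Fin S.N → ℝ≥0∞ := fun i => 2 * (ENNReal.ofReal (S.length i) * D i) with hc
  set R : Fin S.N → Plane × Plane → ℝ≥0∞ := fun i => (S.arc i ×ˢ (S.arc i)ᶜ).indicator
    (fun q => c i * kernel p q.1 q.2) with hR
  set R' : Fin S.N → Plane × Plane → ℝ≥0∞ := fun i => ((S.arc i)ᶜ ×ˢ S.arc i).indicator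
    (fun q => c i * kernel p q.1 q.2) with hR'
  have hpt : ∀ᵐ q ∂Γ.arcLength.prod Γ.arcLength,
      ‖gagliardo r e q‖ₑ ^ 2 ≤ ∑ i, Q i q + (∑ i, R i q + ∑ i, R' i q) := by
    filter_upwards [Measure.quasiMeasurePreserving_fst.ae S.ae_existsUnique_arc,
      Measure.quasiMeasurePreserving_snd.ae S.ae_existsUnique_arc] with q h1 h2
    obtain ⟨i, hi, hi'⟩ := h1
    obtain ⟨j, hj, hj'⟩ := h2
    have e1 : e q.1 = v q.1 - v (x i) := by
      rw [he, Pi.sub_apply, S.piecewiseConst_apply _ hi hi']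
    have e2 : e q.2 = v q.2 - v (x j) := by
      rw [he, Pi.sub_apply, S.piecewiseConst_apply _ hj hj']
    refine (enorm_gagliardo_sq_le r e q).trans ?_
    by_cases hij : i = j
    · subst hij
      refine le_trans (le_of_eq ?_) ((Finset.single_le_sum (f := fun i => Q i q)
        (fun _ _ => zero_le) (Finset.mem_univ i)).trans le_self_add)
      simp only [hQ, indicator_of_mem (show q ∈ S.arc i ×ˢ S.arc i from ⟨hi, hj⟩), e1, e2,
        sub_sub_sub_cancel_right]
      rfl
    · have hiR : q ∈ S.arc i ×ˢ (S.arc i)ᶜ := ⟨hi, fun h => hij (hj' i h)⟩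
      have hjR : q ∈ (S.arc j)ᶜ ×ˢ S.arc j := ⟨fun h => hij (hi' j h).symm, hj⟩
      refine le_trans ?_ ((add_le_add
        (Finset.single_le_sum (f := fun i => R i q) (fun _ _ => zero_le) (Finset.mem_univ i))
        (Finset.single_le_sum (f := fun i => R' i q) (fun _ _ => zero_le)
          (Finset.mem_univ j))).trans le_add_self)
      simp only [hR, hR', indicator_of_mem hiR, indicator_of_mem hjR]
      rw [← add_mul]
      refine mul_le_mul_left ?_ _
      calc ENNReal.ofReal ((e q.1 - e q.2) ^ 2) ≤
            ENNReal.ofReal (2 * e q.1 ^ 2 + 2 * e q.2 ^ 2) :=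
            ENNReal.ofReal_le_ofReal (by nlinarith [sq_nonneg (e q.1 + e q.2)])
        _ = 2 * ENNReal.ofReal (e q.1 ^ 2) + 2 * ENNReal.ofReal (e q.2 ^ 2) := by
            rw [ENNReal.ofReal_add (by positivity) (by positivity),
              ENNReal.ofReal_mul (by norm_num), ENNReal.ofReal_mul (by norm_num),
              ENNReal.ofReal_ofNat]
        _ ≤ _ := by
            rw [e1, e2]
            exact add_le_add
              (mul_le_mul_right (hv.ofReal_sq_sub_le_length hG i hi (hx i)) _)
              (mul_le_mul_right (hv.ofReal_sq_sub_le_length hG j hj (hx j)) _)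
  have hK := measurable_kernel p
  have hF : Measurable fun q : Plane × Plane =>
      ENNReal.ofReal ((v q.1 - v q.2) ^ 2) * kernel p q.1 q.2 := by fun_prop
  have mQ : ∀ i, Measurable (Q i) := fun i =>
    hF.indicator ((S.measurableSet_arc i).prod (S.measurableSet_arc i))
  have mR : ∀ i, Measurable (R i) := fun i =>
    (hK.const_mul _).indicator ((S.measurableSet_arc i).prod (S.measurableSet_arc i).compl)
  have mR' : ∀ i, Measurable (R' i) := fun i =>
    (hK.const_mul _).indicator ((S.measurableSet_arc i).compl.prod (S.measurableSet_arc i))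
  refine (lintegral_mono_ae hpt).trans ?_
  rw [lintegral_add_left (Finset.measurable_fun_sum _ fun i _ => mQ i),
    lintegral_add_left (Finset.measurable_fun_sum _ fun i _ => mR i),
    lintegral_finsetSum _ fun i _ => mQ i, lintegral_finsetSum _ fun i _ => mR i,
    lintegral_finsetSum _ fun i _ => mR' i, ← Finset.sum_add_distrib, ← Finset.sum_add_distrib]
  calc _ ≤ ∑ i, ENNReal.ofReal ((C₁ + 4 * C₂) * l ^ (2 - 2 * r)) * D i := by
        refine Finset.sum_le_sum fun i _ => ?_
        have hli := S.length_pos i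
        have hpow : S.length i * S.length i ^ (2 - p) = S.length i ^ (3 - p) := by
          rw [show 3 - p = 1 + (2 - p) by ring, Real.rpow_add hli, Real.rpow_one]
        have hoff : c i * ∫⁻ x in S.arc i, ∫⁻ y in (S.arc i)ᶜ, kernel p x y
            ∂Γ.arcLength ∂Γ.arcLength ≤
            ENNReal.ofReal (2 * C₂ * S.length i ^ (3 - p)) * D i := by
          refine (mul_le_mul_right (H₂ S i) _).trans_eq ?_
          rw [← hpow, show 2 * C₂ * (S.length i * S.length i ^ (2 - p)) =
            2 * (S.length i * (C₂ * S.length i ^ (2 - p))) by ring,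
            ENNReal.ofReal_mul zero_le_two, ENNReal.ofReal_mul hli.le, ENNReal.ofReal_ofNat]
          simp only [hc]
          ring
        have hQi := lintegral_arc_prod_arc_le (S := S) H₁ hv hG hvm i
        rw [lintegral_indicator_prod_compl (S.measurableSet_arc i),
          lintegral_indicator_compl_prod (S.measurableSet_arc i)]
        refine (add_le_add hQi (add_le_add hoff hoff)).trans ?_
        rw [← add_mul, ← add_mul, ← ENNReal.ofReal_add (by positivity) (by positivity),
          ← ENNReal.ofReal_add (by positivity) (by positivity)]
        refine mul_le_mul_left (ENNReal.ofReal_le_ofReal ?_) _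
        rw [show 2 - 2 * r = 3 - p by rw [hp]; ring]
        calc _ = (C₁ + 4 * C₂) * S.length i ^ (3 - p) := by ring
          _ ≤ _ := by
              have h2 := hl i
              gcongr
              linarith
    _ ≤ _ := by
        rw [← Finset.mul_sum]
        gcongr
        exact S.sum_setLIntegral_arc_le hG

end Interpolation

/-! ### The error of the lumped functional -/

/-- The additive map from `H^r` to functions. -/
def FracSobolev.toFunHom (μ : Measure Plane) (r : ℝ) : FracSobolev μ r →+ (Plane → ℝ) where
  toFun w := w.toFun
  map_zero' := rfl
  map_add' := FracSobolev.toFun_add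

section

variable {ω : Set Plane} {Γ : SmoothBoundary ω} (S : Subdivision Γ) {r : ℝ}

theorem Subdivision.piecewiseConst_mem (hχ : ∀ i, S.arcIndicator i ∈ fracSobolev Γ.arcLength r)
    (y : Fin S.N → ℝ) : S.piecewiseConst y ∈ fracSobolev Γ.arcLength r :=
  Submodule.sum_mem _ fun i _ => Submodule.smul_mem _ _ (hχ i)

/-- Lumping a functional at points of the arcs means applying it to a piecewise constant
interpolant. -/
theorem dual_sub_diracSum_eq (hχ : ∀ i, S.arcIndicator i ∈ fracSobolev Γ.arcLength r)
    (φ : DualSobolev Γ.arcLength r) (x : Fin S.N → Plane) {v : Plane → ℝ}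
    (hv : v ∈ fracSobolev Γ.arcLength r) :
    φ (.mk v hv) - diracSum (fun i => φ (.mk (S.arcIndicator i) (hχ i))) x v =
      φ (.mk (v - S.piecewiseConst fun i => v (x i))
        (Submodule.sub_mem _ hv (S.piecewiseConst_mem hχ _))) := by
  have h1 : (FracSobolev.mk (v - S.piecewiseConst fun i => v (x i))
        (Submodule.sub_mem _ hv (S.piecewiseConst_mem hχ _)) : FracSobolev Γ.arcLength r) =
      FracSobolev.mk v hv - ∑ i, v (x i) • FracSobolev.mk (S.arcIndicator i) (hχ i) := by
    have hinj : Function.Injective (FracSobolev.toFunHom Γ.arcLength r) :=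
      fun _ _ h => Subtype.ext h
    apply hinj
    rw [map_sub, map_sum]
    rfl
  rw [h1, map_sub, map_sum]
  simp [diracSum, mul_comm]

/-- The norm of the interpolation error, in terms of the integral of a
function that plays the role of its squared tangential derivative. -/
theorem exists_norm_interpolation_error_le (Γ : SmoothBoundary ω) (hr : 0 ≤ r) (hr' : r < 1 / 2) :
    ∃ C, 0 ≤ C ∧ ∀ (S : Subdivision Γ) (v : Plane → ℝ) (G : Plane → ℝ≥0∞),
      DominatesIncrements Γ v G → Measurable G → Measurable v →
      ∀ x : Fin S.N → Plane, (∀ i, x i ∈ S.arc i) → ∀ l B : ℝ, 0 ≤ l → 0 ≤ B →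
        (∀ i, S.length i ≤ l) → ∫⁻ z, G z ∂Γ.arcLength ≤ ENNReal.ofReal B →
        (eLpNorm (v - S.piecewiseConst fun i => v (x i)) 2 Γ.arcLength).toReal +
          (eLpNorm (gagliardo r (v - S.piecewiseConst fun i => v (x i))) 2
            (Γ.arcLength.prod Γ.arcLength)).toReal ≤ C * √(l ^ (2 - 2 * r) * B) := by
  obtain ⟨C₁, hC₁, H₁⟩ : ∃ C ≥ 0, ∀ (S : Subdivision Γ) (v : Plane → ℝ) (G : Plane → ℝ≥0∞),
      DominatesIncrements Γ v G → Measurable G → Measurable v →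
      ∀ x : Fin S.N → Plane, (∀ i, x i ∈ S.arc i) → ∀ l : ℝ, (∀ i, S.length i ≤ l) →
        ∫⁻ q, ‖gagliardo r (v - S.piecewiseConst fun i => v (x i)) q‖ₑ ^ 2
          ∂Γ.arcLength.prod Γ.arcLength ≤
        ENNReal.ofReal (C * l ^ (2 - 2 * r)) * ∫⁻ z, G z ∂Γ.arcLength := by
    rcases hr.eq_or_lt with rfl | hr0
    · exact ⟨0, le_rfl, fun S v G _ _ _ x _ l _ => by simp [gagliardo]⟩
    · obtain ⟨C, hC, H⟩ := exists_lintegral_gagliardo_interpolation_error_le Γ hr0 hr'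
      exact ⟨C, hC.le, H⟩
  have hΛ := Γ.totalLength_nonneg
  refine ⟨√(Γ.totalLength ^ (2 * r)) + √C₁, by positivity, ?_⟩
  intro S v G hv hG hvm x hx l B hl hB hS hGB
  have h1 := lintegral_interpolation_error_sq_le hv hG hx hS (p := 1 + 2 * r) (by linarith)
    (by linarith)
  have h2 := H₁ S v G hv hG hvm x hx l hS
  rw [add_sub_cancel_left, show 3 - (1 + 2 * r) = 2 - 2 * r by ring] at h1
  have aux : ∀ a : ℝ, 0 ≤ a → ENNReal.ofReal (a * l ^ (2 - 2 * r)) * ∫⁻ z, G z ∂Γ.arcLength ≤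
      ENNReal.ofReal (a * (l ^ (2 - 2 * r) * B)) := fun a ha => by
    rw [← mul_assoc, ENNReal.ofReal_mul (p := a * l ^ (2 - 2 * r)) (by positivity)]
    exact mul_le_mul_right hGB _
  have k1 := eLpNorm_two_le_of_lintegral_le (by positivity)
    (h1.trans (aux (Γ.totalLength ^ (2 * r)) (by positivity)))
  have k2 := eLpNorm_two_le_of_lintegral_le (by positivity) (h2.trans (aux C₁ hC₁))
  rw [add_mul, ← Real.sqrt_mul (by positivity), ← Real.sqrt_mul hC₁]
  exact add_le_add (ENNReal.toReal_le_of_le_ofReal (Real.sqrt_nonneg _) k1)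
    (ENNReal.toReal_le_of_le_ofReal (Real.sqrt_nonneg _) k2)

end

end SingleLayer

theorem proposition1 (ω : Set Plane) (hω : IsOpen ω) (hω_conn : IsConnected ω)
    (hω_sub : closure ω ⊆ unitSquare) (Γ : SmoothBoundary ω)
    (s : ℝ) (hs : 0 < s) (hs' : s ≤ 1 / 2)
    (σ c c' : ℝ) (hσ : 0 < σ) (hc : 0 < c) (hc' : c < c') :
    ∃ C : ℝ, 0 < C ∧
      ∀ (h : ℝ) (T : Triangulation unitSquare), 0 < h → T.IsRegular σ h →
      ∀ (h' : ℝ) (S : Subdivision Γ), 0 < h' → S.IsQuasiUniform c c' h' →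
      ∀ x : Fin S.N → Plane, (∀ i, x i ∈ S.arc i) →
        ∃ hχ : ∀ i, S.arcIndicator i ∈ fracSobolev Γ.arcLength (1 / 2 - s),
        ∀ (φ : DualSobolev Γ.arcLength (1 / 2 - s)) (v : Plane → ℝ), T.IsP1 v →
          ∃ hv : v ∈ fracSobolev Γ.arcLength (1 / 2 - s),
            |φ (.mk v hv) - diracSum (fun i => φ (.mk (S.arcIndicator i) (hχ i))) x v| ≤
              C * √(h' / h) * h' ^ s * ‖φ‖ * h1Seminorm unitSquare v := by
  have hr : 0 ≤ 1 / 2 - s := by linarith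
  have hr' : 1 / 2 - s < 1 / 2 := by linarith
  have hc0 : 0 < c' := hc.trans hc'
  obtain ⟨C₀, hC₀, H₀⟩ := exists_lintegral_gradientSq_le Γ hσ
  obtain ⟨C₁, hC₁, H₁⟩ := exists_norm_interpolation_error_le Γ hr hr'
  have hfr : frontier ω ⊆ unitSquare := frontier_subset_closure.trans hω_sub
  have hcomp : IsCompact (frontier ω) :=
    Metric.isCompact_of_isClosed_isBounded isClosed_frontier (isBounded_unitSquare.subset hfr)
  refine ⟨C₁ * √(c' ^ (1 + 2 * s) * C₀) + 1, by positivity,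
    fun h T hh hT h' S hh' hS x hx => ?_⟩
  have hχ : ∀ i, S.arcIndicator i ∈ fracSobolev Γ.arcLength (1 / 2 - s) := fun i => by
    refine indicator_mem_fracSobolev (S.measurableSet_arc i) fun hne => ?_
    have hpos : 0 < 1 / 2 - s := lt_of_le_of_ne hr hne.symm
    obtain ⟨C, -, H⟩ := exists_lintegral_kernel_arc_compl_le Γ (p := 1 + 2 * (1 / 2 - s))
      (by linarith) (by linarith)
    exact ne_top_of_le_ne_top ENNReal.ofReal_ne_top (H S i)
  refine ⟨hχ, fun φ v hv => ?_⟩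
  -- outside the closed square the values of `v` are arbitrary: pass to a Lipschitz extension
  obtain ⟨M, hM⟩ := hv.exists_lipschitzOnWith isOpen_unitSquare convex_unitSquare
  obtain ⟨w, hw, hvw⟩ := hM.extend_real
  have hfr' : frontier ω ⊆ closure unitSquare := hfr.trans subset_closure
  have hae : v =ᵐ[Γ.arcLength] w := Γ.ae_mem_frontier.mono fun z hz => hvw (hfr' hz)
  have hvmem : v ∈ fracSobolev Γ.arcLength (1 / 2 - s) := mem_fracSobolev_of_ae_eq hae
    (mem_fracSobolev_of_lipschitzWith hcomp Γ.ae_mem_frontier hr hr' hw)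
  refine ⟨hvmem, ?_⟩
  choose! g hg using hv.2
  have hX : ∀ k t, Γ.X k t ∈ closure unitSquare := fun k t => hfr' (Γ.X_mem_frontier k t)
  have hdom : DominatesIncrements Γ w (T.gradientSq g) := fun k a b hab => by
    rw [← hvw (hX k b), ← hvw (hX k a)]
    exact Triangulation.ofReal_sq_sub_le_lintegral_gradientSq isOpen_unitSquare convex_unitSquare
      hv hg (Γ.lipschitzWith_X k) (hX k) hab
  set H := h1Seminorm unitSquare v with hH
  have hH0 : 0 ≤ H := Real.sqrt_nonneg _
  have hnorm := H₁ S w (T.gradientSq g) hdom (Triangulation.measurable_gradientSq g)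
    hw.continuous.measurable x hx (c' * h') (C₀ / h * H ^ 2) (by positivity) (by positivity)
    (fun i => (hS i).2) (H₀ h T hh hT v g hg)
  have hval : (fun i => v (x i)) = fun i => w (x i) := funext fun i => by
    have := S.cover ▸ mem_iUnion_of_mem (s := S.arc) i (hx i)
    exact hvw (hfr' this)
  have hae' : v - S.piecewiseConst (fun i => v (x i)) =ᵐ[Γ.arcLength]
      w - S.piecewiseConst fun i => w (x i) := by
    rw [hval]
    exact hae.sub Filter.EventuallyEq.rfl
  have hroot : √((c' * h') ^ (2 - 2 * (1 / 2 - s)) * (C₀ / h * H ^ 2)) =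
      √(c' ^ (1 + 2 * s) * C₀) * (√(h' / h) * h' ^ s * H) := by
    have e1 : √(h' / h) * h' ^ s * H = √(h' / h * (h' ^ s) ^ 2 * H ^ 2) := by
      rw [Real.sqrt_mul (by positivity), Real.sqrt_mul (by positivity), Real.sqrt_sq (by positivity),
        Real.sqrt_sq hH0]
    rw [e1, ← Real.sqrt_mul (by positivity), show 2 - 2 * (1 / 2 - s) = 1 + 2 * s by ring,
      Real.mul_rpow hc0.le hh'.le]
    have e2 : h' ^ (1 + 2 * s) = h' * (h' ^ s) ^ 2 := by
      rw [Real.rpow_add hh', Real.rpow_one, ← Real.rpow_mul_natCast hh'.le, mul_comm 2 s]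
      norm_num
    rw [e2]
    congr 1
    field_simp
  rw [dual_sub_diracSum_eq S hχ φ x hvmem]
  refine (φ.le_opNorm _).trans ?_
  rw [FracSobolev.norm_def, FracSobolev.toFun_mk, eLpNorm_congr_ae hae',
    eLpNorm_congr_ae (gagliardo_congr_ae hae' _)]
  calc _ ≤ ‖φ‖ * (C₁ * (√(c' ^ (1 + 2 * s) * C₀) * (√(h' / h) * h' ^ s * H))) := by
        rw [← hroot]
        exact mul_le_mul_of_nonneg_left hnorm (norm_nonneg _)
    _ = C₁ * √(c' ^ (1 + 2 * s) * C₀) * √(h' / h) * h' ^ s * ‖φ‖ * H := by ring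
    _ ≤ _ := by gcongr; linarith
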